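/- For a domain $\Omega\subseteq\mathbb{C}$ let $\mathcal{M}(\Omega)$ be the set of meromorphic functions on $\Omega$, regarded as functions with values in the Riemann sphere $\hat{\mathbb{C}}=\mathbb{C}\cup\{\infty\}$ (the constant $\infty$ not being included), with the topology of locally uniform convergence with respect to the chordal metric $$\chi(z,w)=\frac{|z-w|}{\sqrt{1+|z|^2}\,\sqrt{1+|w|^2}}\quad(z,w\in\mathbb{C}),\qquad \chi(z,\infty)=\chi(\infty,z)=\frac{1}{\sqrt{1+|z|^2}}\quad(z\in\mathbb{C}),\qquad \chi(\infty,\infty)=0.$$ A function $f\in\mathcal{M}(\Omega)$ is called locally univalent if it has at most simple poles and $f'(z)\neq 0$ for all $z\in\Omega$ with $f(z)\neq\infty$. Let $\mathcal{M}_{l.u.}(\Omega)\subseteq\mathcal{M}(\Omega)$ be the subspace of all locally univalent functions. Then there exists a function $f\in\mathcal{M}_{l.u.}(\mathbb{C})$ such that for every simply connected domain $\Omega\subseteq\mathbb{C}$ the set $\{f(\cdot+n)|_{\Omega} : n=1,2,3,\dots\}$ is dense in $\mathcal{M}_{l.u.}(\Omega)$. -/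

import Mathlib

open TopologicalSpace

noncomputable section

/-- The Riemann sphere `ℂ ∪ {∞}`. It is a separate name for `OnePoint ℂ`, so that it can carry the
chordal metric. -/
def RiemannSphere : Type := OnePoint ℂ

namespace RiemannSphere

/-- The point at infinity. -/
def infty : RiemannSphere := (none : Option ℂ)

/-- The value of a finite point of the sphere, with the convention `∞ ↦ 0`. -/
def toComplex : RiemannSphere → ℂ
  | none => 0
  | some z => z

/-- The chordal distance `χ`. -/
def chordal : RiemannSphere → RiemannSphere → ℝ
  | some z, some w => ‖z - w‖ / (√(1 + ‖z‖ ^ 2) * √(1 + ‖w‖ ^ 2))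
  | some z, none => 1 / √(1 + ‖z‖ ^ 2)
  | none, some w => 1 / √(1 + ‖w‖ ^ 2)
  | none, none => 0

/-- The embedding of the sphere in `ℂ × ℝ` as the sphere of radius `1/2` about `(0, 1/2)`; it is
used only to prove the triangle inequality for `χ`. -/
def embed : RiemannSphere → WithLp 2 (ℂ × ℝ)
  | some z => WithLp.toLp 2 ((1 / (1 + ‖z‖ ^ 2) : ℝ) • z, ‖z‖ ^ 2 / (1 + ‖z‖ ^ 2))
  | none => WithLp.toLp 2 (0, 1)

theorem chordal_eq_dist_embed (p q : RiemannSphere) : chordal p q = dist (embed p) (embed q) := by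
  have key : ∀ z : ℂ, (0 : ℝ) < 1 + ‖z‖ ^ 2 := fun z => by positivity
  rcases p with _ | z <;> rcases q with _ | w
  · simp [chordal]
  · have hw := key w
    rw [WithLp.prod_dist_eq_of_L2]
    simp only [chordal, embed, WithLp.toLp_fst, WithLp.toLp_snd, dist_eq_norm, zero_sub, norm_neg, norm_smul, Real.norm_eq_abs,
      sq_abs, mul_pow]
    rw [← Real.sqrt_one, ← Real.sqrt_div zero_le_one]
    congr 1
    simp only [Real.sqrt_one]
    field_simp
    ring
  · have hz := key z
    rw [WithLp.prod_dist_eq_of_L2]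
    simp only [chordal, embed, WithLp.toLp_fst, WithLp.toLp_snd, dist_eq_norm, sub_zero, norm_smul, Real.norm_eq_abs,
      sq_abs, mul_pow]
    rw [← Real.sqrt_one, ← Real.sqrt_div zero_le_one]
    congr 1
    simp only [Real.sqrt_one]
    field_simp
    ring
  · have hz := key z
    have hw := key w
    rw [WithLp.prod_dist_eq_of_L2]
    simp only [chordal, embed, WithLp.toLp_fst, WithLp.toLp_snd, dist_eq_norm, Real.norm_eq_abs, sq_abs]
    rw [← Real.sqrt_mul hz.le, ← Real.sqrt_sq (norm_nonneg (z - w)),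
      ← Real.sqrt_div (sq_nonneg _)]
    congr 1
    simp only [Complex.sq_norm, Complex.normSq_apply, Complex.sub_re, Complex.sub_im,
      Complex.smul_re, Complex.smul_im, smul_eq_mul] at hz hw ⊢
    field_simp
    ring

/-- The Riemann sphere is a metric space under the chordal metric. -/
instance : MetricSpace RiemannSphere where
  dist := chordal
  dist_self p := by rw [chordal_eq_dist_embed, dist_self]
  dist_comm p q := by
    rw [chordal_eq_dist_embed, chordal_eq_dist_embed, dist_comm]
  dist_triangle p q r := by
    simp only [chordal_eq_dist_embed]
    exact dist_triangle _ _ _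
  eq_of_dist_eq_zero {p q} h := by
    have key : ∀ z : ℂ, √(1 + ‖z‖ ^ 2) ≠ 0 := fun z => by positivity
    change chordal p q = 0 at h
    rcases p with _ | z <;> rcases q with _ | w
    · rfl
    · simp [chordal, key] at h
    · simp [chordal, key] at h
    · simp only [chordal, div_eq_zero_iff, mul_eq_zero, key, or_false, norm_eq_zero,
        sub_eq_zero] at h
      rw [h]

end RiemannSphere

/-- The complex-valued function on `ℂ` attached to `f : Ω → ℂ ∪ {∞}`: it is `f` where `f` is
defined and finite, and `0` elsewhere. -/
def finitePart {Ω : Opens ℂ} (f : Ω → RiemannSphere) : ℂ → ℂ := by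
  classical exact fun z => if h : z ∈ Ω then (f ⟨z, h⟩).toComplex else 0

/-- The set `𝓜(Ω)` of meromorphic functions on the open set `Ω`, as sphere-valued functions: they
are analytic at every point of `Ω` where they are finite, and every point of `Ω` where they take
the value `∞` is a pole. (Poles are isolated, so the function that is constantly `∞` is not
included.) -/
structure MeromorphicFunction (Ω : Opens ℂ) where
  toFun : Ω → RiemannSphere
  analyticAt : ∀ z : Ω, toFun z ≠ RiemannSphere.infty → AnalyticAt ℂ (finitePart toFun) z
  pole : ∀ z : Ω, toFun z = RiemannSphere.infty →
    MeromorphicAt (finitePart toFun) z ∧ meromorphicOrderAt (finitePart toFun) z < 0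

instance {Ω : Opens ℂ} : CoeFun (MeromorphicFunction Ω) (fun _ => Ω → RiemannSphere) :=
  ⟨MeromorphicFunction.toFun⟩

/-- The topology of locally uniform convergence with respect to the chordal metric, that is (`Ω`
being locally compact), of uniform convergence on the compact subsets of `Ω`. -/
instance {Ω : Opens ℂ} : TopologicalSpace (MeromorphicFunction Ω) :=
  TopologicalSpace.induced
    (fun f => UniformOnFun.ofFun {K : Set Ω | IsCompact K} f.toFun) inferInstance

/-- A meromorphic function is locally univalent if it has at most simple poles and its derivative
does not vanish at any point where it is finite. -/
def MeromorphicFunction.IsLocallyUnivalent {Ω : Opens ℂ} (f : MeromorphicFunction Ω) : Prop :=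
  (∀ z : Ω, f z = RiemannSphere.infty → -1 ≤ meromorphicOrderAt (finitePart f) z) ∧
  (∀ z : Ω, f z ≠ RiemannSphere.infty → deriv (finitePart f) z ≠ 0)

/-- The space `𝓜_{l.u.}(Ω)` of locally univalent meromorphic functions on `Ω`, with the subspace
topology. -/
abbrev LocallyUnivalentFunction (Ω : Opens ℂ) : Type :=
  {f : MeromorphicFunction Ω // f.IsLocallyUnivalent}

/-- The function `z ↦ f (z + a)` on `Ω`, for `f` defined on `ℂ`. -/
def translateFun (f : (⊤ : Opens ℂ) → RiemannSphere) (a : ℂ) (Ω : Opens ℂ) : Ω → RiemannSphere :=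
  fun z => f ⟨(z : ℂ) + a, trivial⟩

theorem finitePart_translateFun (f : (⊤ : Opens ℂ) → RiemannSphere) (a : ℂ) (Ω : Opens ℂ)
    (z : Ω) :
    finitePart (translateFun f a Ω) =ᶠ[nhds (z : ℂ)] (fun w => finitePart f (w + a)) := by
  filter_upwards [Ω.isOpen.mem_nhds z.2] with w hw
  have hw' : w ∈ Ω := hw
  simp [finitePart, translateFun, hw']

/-- The restriction to `Ω` of the translate `f(· + a)` of a meromorphic function `f` on `ℂ`. -/
def MeromorphicFunction.translate (f : MeromorphicFunction ⊤) (a : ℂ) (Ω : Opens ℂ) :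
    MeromorphicFunction Ω where
  toFun := translateFun f a Ω
  analyticAt z hz := by
    rw [analyticAt_congr (finitePart_translateFun f a Ω z)]
    have h := f.analyticAt ⟨(z : ℂ) + a, trivial⟩ hz
    exact h.comp_of_eq (f := fun w : ℂ => w + a) (by fun_prop) rfl
  pole z hz := by
    have h := f.pole ⟨(z : ℂ) + a, trivial⟩ hz
    have e := (finitePart_translateFun f a Ω z).filter_mono
      (nhdsWithin_le_nhds (s := {(z : ℂ)}ᶜ))
    rw [MeromorphicAt.meromorphicAt_congr e, meromorphicOrderAt_congr e]
    rw [meromorphicAt_fun_comp_add_const_iff_meromorphicAt,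
      meromorphicOrderAt_fun_comp_add_const_eq_meromorphicOrderAt]
    exact h

/-- The restriction to `Ω` of the translate `f(· + a)` of a locally univalent meromorphic function
`f` on `ℂ`. -/
def LocallyUnivalentFunction.translate (f : LocallyUnivalentFunction ⊤) (a : ℂ) (Ω : Opens ℂ) :
    LocallyUnivalentFunction Ω :=
  ⟨f.1.translate a Ω, by
    refine ⟨fun z hz => ?_, fun z hz => ?_⟩
    · have h := f.2.1 ⟨(z : ℂ) + a, trivial⟩ hz
      have e := (finitePart_translateFun f.1 a Ω z).filter_mono
        (nhdsWithin_le_nhds (s := {(z : ℂ)}ᶜ))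
      change -1 ≤ meromorphicOrderAt (finitePart (translateFun f.1 a Ω)) z
      rw [meromorphicOrderAt_congr e, meromorphicOrderAt_fun_comp_add_const_eq_meromorphicOrderAt]
      exact h
    · have h := f.2.2 ⟨(z : ℂ) + a, trivial⟩ hz
      change deriv (finitePart (translateFun f.1 a Ω)) z ≠ 0
      rw [(finitePart_translateFun f.1 a Ω z).deriv_eq, deriv_comp_add_const]
      exact h⟩

end

/-!
In homogeneous coordinates a map to the sphere is `[v]` for a curve `v` in `ℂ²`, and it is locally
univalent exactly when `v` and `v'` are everywhere independent, that is, when `v` solves a linear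
equation `v'' = p v' + q v` with nonvanishing Wronskian. Locally univalent functions are thereby
replaced by pairs of holomorphic functions `(p, q)`, which are subject to no condition at all.

On a simply connected domain, Runge's theorem makes `p` and `q` entire, and solutions depend
continuously on the coefficients. Given two entire equations, the coefficients of the first near
`0` and of the second near a large integer `n` can be joined continuously along the segment `[0, n]`
so that the flow carries a prescribed solution of the first equation to one of the second; since
Gaussian convolutions approximate the joined coefficients both on that segment and on discs around
its end points, some entire equation is close to the first one near `0`, while its solution is close
to that of the second near `n`. By Baire's theorem the translates of a solution of a generic entire
equation are then dense in all solutions.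
-/

open Set Filter Topology Metric MeasureTheory

/-! ### Linear differential equations in the complex plane -/

section LinearODE

variable {E : Type*} [NormedAddCommGroup E] [NormedSpace ℂ E]

theorem norm_le_of_hasDerivAt_of_norm_le_pow {f f' : ℂ → E} {C R : ℝ} {n : ℕ}
    (hf : ∀ z, HasDerivAt f (f' z) z) (hf0 : f 0 = 0)
    (hf' : ∀ z, ‖z‖ ≤ R → ‖f' z‖ ≤ C * ‖z‖ ^ n) {z : ℂ} (hz : ‖z‖ ≤ R) :
    ‖f z‖ ≤ C * ‖z‖ ^ (n + 1) / (n + 1) := by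
  have hray (t : ℝ) : HasDerivAt (fun t : ℝ => f (t * z)) (z • f' (t * z)) t := by
    have hline : HasDerivAt (fun t : ℝ => (t : ℂ) * z) z t := by
      simpa using (Complex.ofRealCLM.hasDerivAt (x := t)).mul_const z
    exact (hf (t * z)).scomp t hline
  have hpow (t : ℝ) : HasDerivAt (fun t : ℝ => C * ‖z‖ ^ (n + 1) / (n + 1) * t ^ (n + 1))
      (C * ‖z‖ ^ (n + 1) * t ^ n) t := by
    refine ((hasDerivAt_pow (n + 1) t).const_mul (C * ‖z‖ ^ (n + 1) / (n + 1))).congr_deriv ?_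
    rw [Nat.add_sub_cancel]
    push_cast
    field_simp
  have hbound (t : ℝ) (ht : t ∈ Ico (0 : ℝ) 1) :
      ‖z • f' (t * z)‖ ≤ C * ‖z‖ ^ (n + 1) * t ^ n := by
    have htz : ‖(t : ℂ) * z‖ = t * ‖z‖ := by
      rw [norm_mul, Complex.norm_real, Real.norm_of_nonneg ht.1]
    have hle := hf' (t * z) (by rw [htz]; nlinarith [ht.1, ht.2, norm_nonneg z])
    rw [htz] at hle
    calc ‖z • f' (t * z)‖ = ‖z‖ * ‖f' (t * z)‖ := norm_smul _ _
      _ ≤ ‖z‖ * (C * (t * ‖z‖) ^ n) := by gcongr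
      _ = _ := by ring
  simpa using image_norm_le_of_norm_deriv_right_le_deriv_boundary (a := 0) (b := 1)
    (fun t _ => (hray t).continuousAt.continuousWithinAt) (fun t _ => (hray t).hasDerivWithinAt)
    (by simp [hf0]) hpow hbound (right_mem_Icc.2 zero_le_one)

variable {A : ℂ → E →L[ℂ] E}

/-- The functions `u n` are the successive terms of the Picard series, with initial value `x` at
the origin, of the linear equation `u' = A u`. -/
structure IsPicardSeries (A : ℂ → E →L[ℂ] E) (x : E) (u : ℕ → ℂ → E) : Prop where
  zero : ∀ z, u 0 z = x
  succ_apply_zero : ∀ n, u (n + 1) 0 = 0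
  hasDerivAt_succ : ∀ n z, HasDerivAt (u (n + 1)) (A z (u n z)) z

theorem exists_isPicardSeries [CompleteSpace E] (hA : Differentiable ℂ A) (x : E) :
    ∃ u, IsPicardSeries A x u := by
  have exists_primitive (g : {g : ℂ → E // Differentiable ℂ g}) :
      ∃ G : {g : ℂ → E // Differentiable ℂ g},
        G.1 0 = 0 ∧ ∀ z, HasDerivAt G.1 (A z (g.1 z)) z := by
    obtain ⟨G, hG0, hG⟩ := (hA.clm_apply g.2).isExactOn_univ.with_val_at 0 0
    exact ⟨⟨G, fun z => (hG z trivial).differentiableAt⟩, hG0, fun z => hG z trivial⟩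
  choose J hJ0 hJ using exists_primitive
  exact ⟨fun n => (J^[n] ⟨fun _ => x, differentiable_const x⟩).1, fun _ => rfl,
    fun n => by rw [Function.iterate_succ_apply']; exact hJ0 _,
    fun n z => by rw [Function.iterate_succ_apply']; exact hJ _ z⟩

namespace IsPicardSeries

variable {x : E} {u : ℕ → ℂ → E} {B R : ℝ}

theorem norm_le (hu : IsPicardSeries A x u) (hA : ∀ z, ‖z‖ ≤ R → ‖A z‖ ≤ B) (n : ℕ) {z : ℂ}
    (hz : ‖z‖ ≤ R) : ‖u n z‖ ≤ ‖x‖ * B ^ n / n.factorial * ‖z‖ ^ n := by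
  induction n generalizing z with
  | zero => simp [hu.zero]
  | succ n ih =>
    have hderiv (w : ℂ) (hw : ‖w‖ ≤ R) :
        ‖A w (u n w)‖ ≤ ‖x‖ * B ^ (n + 1) / n.factorial * ‖w‖ ^ n := by
      have hB : 0 ≤ B := (norm_nonneg _).trans (hA w hw)
      calc ‖A w (u n w)‖ ≤ ‖A w‖ * ‖u n w‖ := (A w).le_opNorm _
        _ ≤ B * (‖x‖ * B ^ n / n.factorial * ‖w‖ ^ n) := by gcongr; exacts [hA w hw, ih hw]
        _ = _ := by ring
    refine (norm_le_of_hasDerivAt_of_norm_le_pow (hu.hasDerivAt_succ n) (hu.succ_apply_zero n)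
      hderiv hz).trans_eq ?_
    rw [Nat.factorial_succ]
    push_cast
    field_simp

theorem norm_le_pow_div_factorial (hu : IsPicardSeries A x u) (hA : ∀ z, ‖z‖ ≤ R → ‖A z‖ ≤ B)
    (n : ℕ) {z : ℂ} (hz : ‖z‖ ≤ R) : ‖u n z‖ ≤ ‖x‖ * ((B * R) ^ n / n.factorial) := by
  have hB : 0 ≤ B := (norm_nonneg _).trans (hA z hz)
  calc ‖u n z‖ ≤ ‖x‖ * B ^ n / n.factorial * ‖z‖ ^ n := hu.norm_le hA n hz
    _ ≤ ‖x‖ * B ^ n / n.factorial * R ^ n := by gcongr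
    _ = _ := by rw [mul_pow]; ring

theorem tsum_apply_zero (hu : IsPicardSeries A x u) : ∑' n, u n 0 = x := by
  rw [tsum_eq_single 0 fun n hn => ?_, hu.zero]
  obtain ⟨m, rfl⟩ := Nat.exists_eq_succ_of_ne_zero hn
  exact hu.succ_apply_zero m

theorem hasDerivAt_tsum [CompleteSpace E] (hu : IsPicardSeries A x u) (hA : Continuous A)
    (z : ℂ) : HasDerivAt (fun z => ∑' n, u n z) (A z (∑' n, u n z)) z := by
  set R := ‖z‖ + 1
  obtain ⟨B, hB⟩ := (isCompact_closedBall (0 : ℂ) R).exists_bound_of_continuousOn hA.continuousOn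
  simp only [mem_closedBall_zero_iff] at hB
  have hsummable : Summable fun n : ℕ => ‖x‖ * ((B * R) ^ n / n.factorial) :=
    (Real.summable_pow_div_factorial _).mul_left _
  have hsummable_apply {w : ℂ} (hw : ‖w‖ ≤ R) : Summable fun n => u n w :=
    .of_norm_bounded hsummable fun n => hu.norm_le_pow_div_factorial hB n hw
  have hderiv_le (n : ℕ) (w : ℂ) (hw : w ∈ ball (0 : ℂ) R) :
      ‖A w (u n w)‖ ≤ B * (‖x‖ * ((B * R) ^ n / n.factorial)) := by
    have hwR : ‖w‖ ≤ R := (mem_ball_zero_iff.1 hw).le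
    have : 0 ≤ B := (norm_nonneg _).trans (hB w hwR)
    refine ((A w).le_opNorm _).trans ?_
    gcongr
    exacts [hB w hwR, hu.norm_le_pow_div_factorial hB n hwR]
  have hz : z ∈ ball (0 : ℂ) R := by simp [R]
  have htail : HasDerivAt (fun w => ∑' n, u (n + 1) w) (∑' n, A z (u n z)) z :=
    hasDerivAt_tsum_of_isPreconnected (hsummable.mul_left B) isOpen_ball
      (convex_ball 0 R).isPreconnected (fun n w _ => hu.hasDerivAt_succ n w) hderiv_le hz
      ((summable_nat_add_iff 1).2 (hsummable_apply (mem_ball_zero_iff.1 hz).le)) hz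
  rw [(A z).map_tsum (hsummable_apply (mem_ball_zero_iff.1 hz).le)]
  refine (htail.const_add x).congr_of_eventuallyEq ?_
  filter_upwards [isOpen_ball.mem_nhds hz] with w hw
  rw [(hsummable_apply (mem_ball_zero_iff.1 hw).le).tsum_eq_zero_add, hu.zero]

end IsPicardSeries

theorem exists_entire_solution [CompleteSpace E] (hA : Differentiable ℂ A) (z₀ : ℂ) (x : E) :
    ∃ u : ℂ → E, u z₀ = x ∧ ∀ z, HasDerivAt u (A z (u z)) z := by
  obtain ⟨u, hu⟩ := exists_isPicardSeries (hA.comp (differentiable_id.add_const z₀)) x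
  refine ⟨fun z => ∑' n, u n (z - z₀), by simpa using hu.tsum_apply_zero, fun z => ?_⟩
  simpa using (hu.hasDerivAt_tsum (hA.continuous.comp (continuous_add_const z₀))
    (z - z₀)).comp_sub_const z z₀

end LinearODE

section ContinuousDependence

variable {ι σ 𝕜 E : Type*} [NontriviallyNormedField 𝕜] [NormedAddCommGroup E] [NormedSpace 𝕜 E]
  [NormedSpace ℝ E] {l : Filter ι} {a b : ℝ}

theorem dist_le_of_dist_coeff_le {A B : ℝ → E →L[𝕜] E} {u v : ℝ → E} {K M δ : ℝ} (hK : 1 ≤ K)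
    (hδ : 0 ≤ δ) (hM : 0 ≤ M) (hA : ∀ t ∈ Icc a b, ‖A t‖ ≤ K)
    (hAB : ∀ t ∈ Icc a b, dist (B t) (A t) ≤ δ) (hv : ∀ t ∈ Icc a b, ‖v t‖ ≤ M)
    (hu' : ∀ t ∈ Icc a b, HasDerivAt u (A t (u t)) t)
    (hv' : ∀ t ∈ Icc a b, HasDerivAt v (B t (v t)) t) (hδa : dist (u a) (v a) ≤ δ) :
    ∀ t ∈ Icc a b, dist (u t) (v t) ≤ δ * ((1 + M) * Real.exp (K * (b - a))) := by
  intro t ht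
  have hgronwall := dist_le_of_approx_trajectories_ODE_of_mem (v := fun t x => A t x)
    (s := fun _ => univ) (K := K.toNNReal) (εf := 0) (εg := δ * M)
    (fun t ht => ((A t).lipschitz.weaken (by
      rw [← NNReal.coe_le_coe, Real.coe_toNNReal _ (by linarith), coe_nnnorm]
      exact hA t (Ico_subset_Icc_self ht))).lipschitzOnWith)
    (fun t ht => (hu' t ht).continuousAt.continuousWithinAt)
    (fun t ht => (hu' t (Ico_subset_Icc_self ht)).hasDerivWithinAt) (by simp) (by simp)
    (fun t ht => (hv' t ht).continuousAt.continuousWithinAt)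
    (fun t ht => (hv' t (Ico_subset_Icc_self ht)).hasDerivWithinAt)
    (fun t ht => by
      have ht' := Ico_subset_Icc_self ht
      rw [dist_eq_norm, ← sub_apply]
      calc ‖(B t - A t) (v t)‖ ≤ ‖B t - A t‖ * ‖v t‖ := (B t - A t).le_opNorm _
        _ ≤ δ * M := by gcongr; exacts [(dist_eq_norm _ _).symm.trans_le (hAB t ht'), hv t ht'])
    (by simp) hδa t ht
  rw [Real.coe_toNNReal _ (by linarith), gronwallBound_of_K_ne_0 (by linarith), zero_add]
    at hgronwall
  have hexp : Real.exp (K * (t - a)) ≤ Real.exp (K * (b - a)) := by gcongr; exact ht.2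
  have : δ * M / K ≤ δ * M := div_le_self (by positivity) hK
  calc dist (u t) (v t) ≤ δ * Real.exp (K * (t - a))
        + δ * M / K * (Real.exp (K * (t - a)) - 1) := hgronwall
    _ ≤ δ * Real.exp (K * (b - a)) + δ * M * (Real.exp (K * (b - a)) - 0) := by
      gcongr
      · linarith [Real.one_le_exp (x := K * (t - a)) (by nlinarith [ht.1])]
      · exact zero_le_one
    _ = _ := by ring

theorem tendstoUniformlyOn_of_hasDerivAt {S : Set σ} {A : σ → ℝ → E →L[𝕜] E}
    {A' : ι → σ → ℝ → E →L[𝕜] E} {u : σ → ℝ → E} {u' : ι → σ → ℝ → E} {K M : ℝ}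
    (hA : ∀ s ∈ S, ∀ t ∈ Icc a b, ‖A s t‖ ≤ K) (hM : ∀ s ∈ S, ∀ t ∈ Icc a b, ‖u s t‖ ≤ M)
    (hu : ∀ s ∈ S, ∀ t ∈ Icc a b, HasDerivAt (u s) (A s t (u s t)) t)
    (hu' : ∀ i, ∀ s ∈ S, ∀ t ∈ Icc a b, HasDerivAt (u' i s) (A' i s t (u' i s t)) t)
    (hlim : TendstoUniformlyOn (fun i (p : σ × ℝ) => A' i p.1 p.2) (fun p => A p.1 p.2) l
      (S ×ˢ Icc a b))
    (hinit : TendstoUniformlyOn (fun i s => u' i s a) (fun s => u s a) l S) :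
    TendstoUniformlyOn (fun i (p : σ × ℝ) => u' i p.1 p.2) (fun p => u p.1 p.2) l
      (S ×ˢ Icc a b) := by
  rw [Metric.tendstoUniformlyOn_iff] at *
  intro ε hε
  set C := (1 + |M|) * Real.exp ((|K| + 1) * (b - a))
  have hC : 0 < C := by positivity
  obtain ⟨δ, hδ, hδ1, hδC⟩ : ∃ δ : ℝ, 0 < δ ∧ δ ≤ 1 ∧ δ * C < ε :=
    ⟨min 1 (ε / (2 * C)), by positivity, min_le_left _ _, calc
      min 1 (ε / (2 * C)) * C ≤ ε / (2 * C) * C := by gcongr; exact min_le_right _ _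
      _ = ε / 2 := by field_simp
      _ < ε := half_lt_self hε⟩
  filter_upwards [hlim δ hδ, hinit δ hδ] with i hi hia p hp
  have hA' (t : ℝ) (ht : t ∈ Icc a b) : ‖A' i p.1 t‖ ≤ |K| + 1 := by
    have hdist := (hi ⟨p.1, t⟩ ⟨hp.1, ht⟩).le
    rw [dist_comm, dist_eq_norm] at hdist
    linarith [norm_le_norm_add_norm_sub' (A' i p.1 t) (A p.1 t), hA _ hp.1 t ht, le_abs_self K]
  rw [dist_comm]
  exact (dist_le_of_dist_coeff_le (by linarith [abs_nonneg K]) hδ.le (abs_nonneg M) hA'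
    (fun t ht => (hi ⟨p.1, t⟩ ⟨hp.1, ht⟩).le) (fun t ht => (hM _ hp.1 t ht).trans (le_abs_self M))
    (hu' i _ hp.1) (hu _ hp.1) (by rw [dist_comm]; exact (hia _ hp.1).le) _ hp.2).trans_lt hδC

theorem tendstoUniformlyOn_Icc_of_hasDerivAt {A : ℝ → E →L[𝕜] E} {A' : ι → ℝ → E →L[𝕜] E}
    {u : ℝ → E} {u' : ι → ℝ → E} (hA : ContinuousOn A (Icc a b))
    (hu : ∀ t ∈ Icc a b, HasDerivAt u (A t (u t)) t)
    (hu' : ∀ i, ∀ t ∈ Icc a b, HasDerivAt (u' i) (A' i t (u' i t)) t)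
    (hlim : TendstoUniformlyOn A' A l (Icc a b)) (hinit : Tendsto (u' · a) l (𝓝 (u a))) :
    TendstoUniformlyOn u' u l (Icc a b) := by
  obtain ⟨K, hK⟩ := isCompact_Icc.exists_bound_of_continuousOn hA
  obtain ⟨M, hM⟩ := isCompact_Icc.exists_bound_of_continuousOn
    fun t ht => (hu t ht).continuousAt.continuousWithinAt
  have hprod := tendstoUniformlyOn_of_hasDerivAt (S := (univ : Set Unit)) (A := fun _ => A)
    (A' := fun i _ => A' i) (u := fun _ => u) (u' := fun i _ => u' i) (fun _ _ => hK)
    (fun _ _ => hM) (fun _ _ => hu) (fun i _ _ => hu' i)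
    ((hlim.comp Prod.snd).mono fun _ hp => hp.2) (hinit.tendstoUniformlyOn_const univ)
  exact (hprod.comp fun t => ((), t)).mono fun t ht => ⟨mem_univ _, ht⟩

end ContinuousDependence

section LocallyUniformDependence

variable {ι E : Type*} [NormedAddCommGroup E] [NormedSpace ℂ E] {l : Filter ι}
  {A : ℂ → E →L[ℂ] E} {A' : ι → ℂ → E →L[ℂ] E} {u : ℂ → E} {u' : ι → ℂ → E}

theorem hasDerivAt_comp_segment {B : E →L[ℂ] E} {z₀ z : ℂ} {t : ℝ}
    (hu : HasDerivAt u (B (u (z₀ + t * (z - z₀)))) (z₀ + t * (z - z₀))) :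
    HasDerivAt (fun t : ℝ => u (z₀ + t * (z - z₀)))
      (((z - z₀) • B) (u (z₀ + t * (z - z₀)))) t := by
  have hline : HasDerivAt (fun t : ℝ => z₀ + (t : ℂ) * (z - z₀)) (z - z₀) t := by
    simpa using ((Complex.ofRealCLM.hasDerivAt (x := t)).mul_const (z - z₀)).const_add z₀
  exact hu.scomp t hline

theorem add_mul_sub_mem_closedBall {z₀ z : ℂ} {R t : ℝ} (hz : z ∈ closedBall z₀ R)
    (ht : t ∈ Icc (0 : ℝ) 1) : z₀ + t * (z - z₀) ∈ closedBall z₀ R := by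
  rw [mem_closedBall, dist_eq_norm] at *
  rw [add_sub_cancel_left, norm_mul, Complex.norm_real, Real.norm_of_nonneg ht.1]
  exact (mul_le_of_le_one_left (norm_nonneg _) ht.2).trans hz

theorem tendstoUniformlyOn_closedBall_of_hasDerivAt {z₀ : ℂ} {R : ℝ}
    (hA : ContinuousOn A (closedBall z₀ R))
    (hu : ∀ z ∈ closedBall z₀ R, HasDerivAt u (A z (u z)) z)
    (hu' : ∀ i, ∀ z ∈ closedBall z₀ R, HasDerivAt (u' i) (A' i z (u' i z)) z)
    (hlim : TendstoUniformlyOn A' A l (closedBall z₀ R))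
    (hinit : Tendsto (u' · z₀) l (𝓝 (u z₀))) :
    TendstoUniformlyOn u' u l (closedBall z₀ R) := by
  obtain ⟨K, hK⟩ := (isCompact_closedBall z₀ R).exists_bound_of_continuousOn hA
  obtain ⟨M, hM⟩ := (isCompact_closedBall z₀ R).exists_bound_of_continuousOn
    fun z hz => (hu z hz).continuousAt.continuousWithinAt
  have hmem : MapsTo (fun p : ℂ × ℝ => z₀ + p.2 * (p.1 - z₀)) (closedBall z₀ R ×ˢ Icc 0 1)
      (closedBall z₀ R) := fun p hp => add_mul_sub_mem_closedBall hp.1 hp.2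
  have hcoeff : TendstoUniformlyOn
      (fun i (p : ℂ × ℝ) => (p.1 - z₀) • A' i (z₀ + p.2 * (p.1 - z₀)))
      (fun p => (p.1 - z₀) • A (z₀ + p.2 * (p.1 - z₀))) l (closedBall z₀ R ×ˢ Icc 0 1) := by
    have hconst : TendstoUniformlyOn (fun (_ : ι) (p : ℂ × ℝ) => p.1 - z₀) (fun p => p.1 - z₀) l
        (closedBall z₀ R ×ˢ Icc 0 1) :=
      fun _ hV => .of_forall fun _ _ _ => refl_mem_uniformity hV
    refine (tendstoLocallyUniformlyOn_iff_tendstoUniformlyOn_of_compact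
      ((isCompact_closedBall z₀ R).prod isCompact_Icc)).1 ?_
    exact hconst.tendstoLocallyUniformlyOn.fun_smul₀
      ((hlim.comp _).mono hmem).tendstoLocallyUniformlyOn (by fun_prop)
      (hA.comp (by fun_prop) hmem)
  have hsegment := tendstoUniformlyOn_of_hasDerivAt (S := closedBall z₀ R) (a := 0) (b := 1)
    (A := fun z t => (z - z₀) • A (z₀ + t * (z - z₀)))
    (A' := fun i z t => (z - z₀) • A' i (z₀ + t * (z - z₀)))
    (u := fun z t => u (z₀ + t * (z - z₀))) (u' := fun i z t => u' i (z₀ + t * (z - z₀)))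
    (K := R * K) (M := M)
    (fun z hz t ht => by
      have hzR : ‖z - z₀‖ ≤ R := by rwa [← dist_eq_norm]
      rw [norm_smul]
      exact mul_le_mul hzR (hK _ (add_mul_sub_mem_closedBall hz ht)) (norm_nonneg _)
        ((norm_nonneg _).trans hzR))
    (fun z hz t ht => hM _ (add_mul_sub_mem_closedBall hz ht))
    (fun z hz t ht => hasDerivAt_comp_segment (hu _ (add_mul_sub_mem_closedBall hz ht)))
    (fun i z hz t ht => hasDerivAt_comp_segment (hu' i _ (add_mul_sub_mem_closedBall hz ht)))
    hcoeff (by simpa using hinit.tendstoUniformlyOn_const _)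
  simpa [Function.comp_def] using (hsegment.comp fun z => (z, (1 : ℝ))).mono
    fun z hz => ⟨hz, right_mem_Icc.2 zero_le_one⟩

theorem tendstoLocallyUniformlyOn_of_hasDerivAt {U : Set ℂ} (hU : IsOpen U)
    (hUc : IsPreconnected U) (hA : ContinuousOn A U) (hu : ∀ z ∈ U, HasDerivAt u (A z (u z)) z)
    (hu' : ∀ i, ∀ z ∈ U, HasDerivAt (u' i) (A' i z (u' i z)) z)
    (hlim : TendstoLocallyUniformlyOn A' A l U) {z₀ : ℂ} (hz₀ : z₀ ∈ U)
    (hinit : Tendsto (u' · z₀) l (𝓝 (u z₀))) : TendstoLocallyUniformlyOn u' u l U := by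
  have hball {z : ℂ} {r : ℝ} (hr : closedBall z r ⊆ U) (hz : Tendsto (u' · z) l (𝓝 (u z))) :
      TendstoUniformlyOn u' u l (closedBall z r) :=
    tendstoUniformlyOn_closedBall_of_hasDerivAt (hA.mono hr) (fun w hw => hu w (hr hw))
      (fun i w hw => hu' i w (hr hw)) ((tendstoLocallyUniformlyOn_iff_forall_isCompact hU).1 hlim _
        hr (isCompact_closedBall z r)) hz
  have htendsto {z : ℂ} (hz : z ∈ U) : Tendsto (u' · z) l (𝓝 (u z)) := by
    refine hUc.induction₂' (fun z w => Tendsto (u' · z) l (𝓝 (u z)) → Tendsto (u' · w) l (𝓝 (u w)))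
      (fun z hz => ?_) (fun _ _ _ _ _ _ h₁ h₂ => h₂ ∘ h₁) hz₀ hz hinit
    obtain ⟨r, hr, hrU⟩ := Metric.isOpen_iff.1 hU z hz
    filter_upwards [mem_nhdsWithin_of_mem_nhds (closedBall_mem_nhds z (half_pos (half_pos hr)))]
      with w hw
    rw [mem_closedBall] at hw
    refine ⟨fun h => (hball (r := r / 2) ?_ h).tendsto_at (by rw [mem_closedBall]; linarith),
      fun h => (hball (r := r / 4) ?_ h).tendsto_at (by rw [mem_closedBall, dist_comm]; linarith)⟩
    · exact (closedBall_subset_ball (half_lt_self hr)).trans hrU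
    · exact (closedBall_subset_ball' (by linarith)).trans hrU
  rw [tendstoLocallyUniformlyOn_iff_forall_tendsto]
  intro z hz
  obtain ⟨r, hr, hrU⟩ := Metric.nhds_basis_closedBall.mem_iff.1 (hU.mem_nhds hz)
  exact (tendstoUniformlyOn_iff_tendsto.1 (hball hrU (htendsto hz))).mono_left <|
    Filter.prod_mono le_rfl <|
      nhdsWithin_le_nhds.trans (le_principal_iff.2 (closedBall_mem_nhds z hr))

end LocallyUniformDependence

/-! ### Second order equations for plane curves -/

section Components

variable {𝕜 E F : Type*} [NontriviallyNormedField 𝕜] [NormedAddCommGroup E] [NormedSpace 𝕜 E]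
  [NormedAddCommGroup F] [NormedSpace 𝕜 F] {u : 𝕜 → E × F} {u' : E × F} {z : 𝕜}

theorem hasDerivAt_fst_comp (hu : HasDerivAt u u' z) : HasDerivAt (fun z => (u z).1) u'.1 z :=
  (ContinuousLinearMap.fst 𝕜 E F).hasFDerivAt.comp_hasDerivAt z hu

theorem hasDerivAt_snd_comp (hu : HasDerivAt u u' z) : HasDerivAt (fun z => (u z).2) u'.2 z :=
  (ContinuousLinearMap.snd 𝕜 E F).hasFDerivAt.comp_hasDerivAt z hu

end Components

section Wedge

/-- The exterior product of two vectors of the plane. -/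
def wedge {R : Type*} [CommRing R] (v w : R × R) : R := v.1 * w.2 - v.2 * w.1

theorem ne_zero_of_wedge_ne_zero {R : Type*} [CommRing R] {v w : R × R} (h : wedge v w ≠ 0) :
    v ≠ 0 := by
  rintro rfl
  simp [wedge] at h

/-- The coefficients `(p, q)` such that `a = q v + p w`, where `x = (v, w)` is a basis of the
plane; they are given by Cramer's rule. -/
def cramerCoeff {K : Type*} [Field K] (x : (K × K) × (K × K)) (a : K × K) : K × K :=
  (wedge x.1 a / wedge x.1 x.2, wedge a x.2 / wedge x.1 x.2)

end Wedge

section Companion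

variable {𝕜 E : Type*} [NontriviallyNormedField 𝕜] [NormedAddCommGroup E] [NormedSpace 𝕜 E]

/-- The matrix of the first order system, for the pair `(v, v')`, equivalent to the second order
equation `v'' = p v' + q v` with coefficients `c = (p, q)`. -/
def companion (E : Type*) [NormedAddCommGroup E] [NormedSpace 𝕜 E] (c : 𝕜 × 𝕜) :
    E × E →L[𝕜] E × E :=
  .inl 𝕜 E E ∘L .snd 𝕜 E E
    + (c.1 • .inr 𝕜 E E ∘L .snd 𝕜 E E + c.2 • .inr 𝕜 E E ∘L .fst 𝕜 E E)

theorem companion_apply (c : 𝕜 × 𝕜) (x : E × E) :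
    companion E c x = (x.2, c.1 • x.2 + c.2 • x.1) := by
  simp [companion]

theorem differentiable_companion : Differentiable 𝕜 (companion (𝕜 := 𝕜) E) := by
  unfold companion
  fun_prop

theorem uniformContinuous_companion : UniformContinuous (companion (𝕜 := 𝕜) E) := by
  unfold companion
  have hlin (L : E × E →L[𝕜] E × E) : UniformContinuous fun a : 𝕜 => a • L :=
    ((ContinuousLinearMap.id 𝕜 𝕜).smulRight L).uniformContinuous
  exact uniformContinuous_const.add
    (((hlin _).comp uniformContinuous_fst).add ((hlin _).comp uniformContinuous_snd))

variable {x : (𝕜 × 𝕜) × (𝕜 × 𝕜)}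

theorem companion_cramerCoeff (hx : wedge x.1 x.2 ≠ 0) (a : 𝕜 × 𝕜) :
    companion (𝕜 × 𝕜) (cramerCoeff x a) x = (x.2, a) := by
  rw [companion_apply]
  ext <;> simp only [cramerCoeff, Prod.fst_add, Prod.snd_add, Prod.smul_fst, Prod.smul_snd,
    smul_eq_mul] <;> field_simp <;> simp only [wedge] <;> ring

theorem cramerCoeff_companion (hx : wedge x.1 x.2 ≠ 0) (c : 𝕜 × 𝕜) :
    cramerCoeff x (companion (𝕜 × 𝕜) c x).2 = c := by
  rw [companion_apply]
  ext <;> rw [cramerCoeff, div_eq_iff hx] <;>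
    simp only [wedge, Prod.fst_add, Prod.snd_add, Prod.smul_fst, Prod.smul_snd, smul_eq_mul] <;>
    ring

theorem continuous_wedge : Continuous fun x : (𝕜 × 𝕜) × (𝕜 × 𝕜) => wedge x.1 x.2 := by
  unfold wedge
  fun_prop

theorem hasDerivAt_wedge {c : 𝕜 × 𝕜} {u : 𝕜 → (𝕜 × 𝕜) × (𝕜 × 𝕜)} {z : 𝕜}
    (hu : HasDerivAt u (companion (𝕜 × 𝕜) c (u z)) z) :
    HasDerivAt (fun z => wedge (u z).1 (u z).2) (c.1 * wedge (u z).1 (u z).2) z := by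
  rw [companion_apply] at hu
  have hv := hasDerivAt_fst_comp hu
  have hv' := hasDerivAt_snd_comp hu
  refine (((hasDerivAt_fst_comp hv).mul (hasDerivAt_snd_comp hv')).sub
    ((hasDerivAt_snd_comp hv).mul (hasDerivAt_fst_comp hv'))).congr_deriv ?_
  simp only [wedge, Prod.fst_add, Prod.snd_add, Prod.smul_fst, Prod.smul_snd, smul_eq_mul]
  ring

/-- `u = (v, v')` for a curve `v` satisfying `v'' = p v' + q v` on the whole field, where
`c = (p, q)`. -/
def IsSolution (c : 𝕜 → 𝕜 × 𝕜) (u : 𝕜 → E × E) : Prop :=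
  ∀ z, HasDerivAt u (companion E (c z) (u z)) z

end Companion

theorem exists_isSolution {E : Type*} [NormedAddCommGroup E] [NormedSpace ℂ E] [CompleteSpace E]
    {c : ℂ → ℂ × ℂ} (hc : Differentiable ℂ c) (z₀ : ℂ) (x : E × E) :
    ∃ u, IsSolution c u ∧ u z₀ = x := by
  obtain ⟨u, hu₀, hu⟩ := exists_entire_solution (differentiable_companion.comp hc) z₀ x
  exact ⟨u, hu, hu₀⟩

theorem IsSolution.wedge_ne_zero {c : ℂ → ℂ × ℂ} {u : ℂ → (ℂ × ℂ) × (ℂ × ℂ)}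
    (hu : IsSolution c u) (hc : Differentiable ℂ c) {z₀ : ℂ} (h₀ : wedge (u z₀).1 (u z₀).2 ≠ 0)
    (z : ℂ) : wedge (u z).1 (u z).2 ≠ 0 := by
  obtain ⟨P, hP⟩ := hc.fst.isExactOn_univ
  -- Abel's identity: the Wronskian is a constant multiple of `exp P`, where `P' = p`.
  have hderiv (z : ℂ) :
      HasDerivAt (fun z => wedge (u z).1 (u z).2 * Complex.exp (-P z)) 0 z := by
    refine ((hasDerivAt_wedge (hu z)).mul (hP z trivial).neg.cexp).congr_deriv ?_
    ring
  have hconst := is_const_of_deriv_eq_zero (fun z => (hderiv z).differentiableAt)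
    (fun z => (hderiv z).deriv) z z₀
  intro hz
  rw [hz, zero_mul] at hconst
  exact mul_ne_zero h₀ (Complex.exp_ne_zero _) hconst.symm

/-! ### The Cauchy–Pompeiu formula -/

section Pompeiu

variable {E : Type*} [NormedAddCommGroup E] [NormedSpace ℂ E] {φ : ℂ → E}

/-- Twice the Wirtinger derivative `∂φ/∂z̄`. -/
noncomputable def dbar (φ : ℂ → E) (z : ℂ) : E :=
  fderiv ℝ φ z 1 + Complex.I • fderiv ℝ φ z Complex.I

theorem continuous_dbar (hφ : ContDiff ℝ 1 φ) : Continuous (dbar φ) := by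
  have := hφ.continuous_fderiv one_ne_zero
  unfold dbar
  fun_prop

theorem dbar_eq_zero_of_differentiableAt {z : ℂ} (hφ : DifferentiableAt ℂ φ z) :
    dbar φ z = 0 := by
  have hfderiv : fderiv ℝ φ z Complex.I = Complex.I • fderiv ℝ φ z 1 := by
    rw [hφ.fderiv_restrictScalars ℝ, ContinuousLinearMap.coe_restrictScalars', ← map_smul,
      smul_eq_mul, mul_one]
  rw [dbar, hfderiv, smul_smul, Complex.I_mul_I, neg_one_smul, add_neg_cancel]

theorem hasCompactSupport_dbar (hφ : HasCompactSupport φ) : HasCompactSupport (dbar φ) := by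
  refine HasCompactSupport.intro (hφ.fderiv ℝ) fun z hz => ?_
  simp [dbar, image_eq_zero_of_notMem_tsupport hz]

theorem exp_neg_smul_dbar (φ : ℂ → E) (z : ℂ) (θ : ℝ) :
    Complex.exp (-(θ * Complex.I)) • dbar φ z = fderiv ℝ φ z (Complex.exp (θ * Complex.I))
      + Complex.I • fderiv ℝ φ z (Complex.exp (θ * Complex.I) * Complex.I) := by
  have hlin (w : ℂ) : fderiv ℝ φ z w
      = (w.re : ℂ) • fderiv ℝ φ z 1 + (w.im : ℂ) • fderiv ℝ φ z Complex.I := by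
    conv_lhs => rw [← Complex.re_add_im w]
    simp only [Complex.coe_smul, ← map_smul, ← map_add, Complex.real_smul, mul_one]
  have hexp : Complex.exp (-(θ * Complex.I)) = Real.cos θ - Real.sin θ * Complex.I := by
    rw [← neg_mul, ← Complex.ofReal_neg, Complex.exp_mul_I]
    simp [sub_eq_add_neg]
  rw [hlin, hlin (Complex.exp _ * _), dbar, hexp]
  simp only [Complex.mul_re, Complex.mul_im, Complex.I_re, Complex.I_im, mul_zero, mul_one,
    zero_sub, add_zero, Complex.exp_ofReal_mul_I_re, Complex.exp_ofReal_mul_I_im,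
    Complex.ofReal_neg]
  match_scalars
  · ring
  · linear_combination (-Complex.sin θ) * Complex.I_mul_I

theorem hasDerivAt_comp_ray (hφ : ContDiff ℝ 1 φ) (r θ : ℝ) :
    HasDerivAt (fun r : ℝ => φ (r * Complex.exp (θ * Complex.I)))
      (fderiv ℝ φ (r * Complex.exp (θ * Complex.I)) (Complex.exp (θ * Complex.I))) r := by
  refine (hφ.differentiable one_ne_zero _).hasFDerivAt.comp_hasDerivAt r ?_
  simpa using (Complex.ofRealCLM.hasDerivAt (x := r)).mul_const (Complex.exp (θ * Complex.I))

theorem hasDerivAt_comp_circle (hφ : ContDiff ℝ 1 φ) (r θ : ℝ) :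
    HasDerivAt (fun θ : ℝ => φ (r * Complex.exp (θ * Complex.I)))
      (r • fderiv ℝ φ (r * Complex.exp (θ * Complex.I))
        (Complex.exp (θ * Complex.I) * Complex.I)) θ := by
  rw [← map_smul, Complex.real_smul]
  refine (hφ.differentiable one_ne_zero _).hasFDerivAt.comp_hasDerivAt θ ?_
  simpa using ((Complex.ofRealCLM.hasDerivAt (x := θ)).mul_const Complex.I).cexp.const_mul (r : ℂ)

theorem integrableOn_polar {F : Type*} [NormedAddCommGroup F] {G : ℝ × ℝ → F} (hG : Continuous G)
    {R : ℝ} (hR : ∀ r θ, R < r → G (r, θ) = 0) :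
    IntegrableOn G (Ioi 0 ×ˢ Ioo (-Real.pi) Real.pi) := by
  refine (hG.continuousOn.integrableOn_compact (isCompact_Icc.prod isCompact_Icc) :
    IntegrableOn G (Icc 0 R ×ˢ Icc (-Real.pi) Real.pi)).of_forall_sdiff_eq_zero
      (measurableSet_Ioi.prod measurableSet_Ioo) ?_
  rintro ⟨r, θ⟩ ⟨⟨hr, hθ⟩, hnot⟩
  exact hR r θ (not_le.1 fun hrR => hnot ⟨⟨hr.out.le, hrR⟩, Ioo_subset_Icc_self hθ⟩)

theorem exists_fderiv_polar_eq_zero (hc : HasCompactSupport φ) :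
    ∃ R, ∀ r θ : ℝ, R < r → fderiv ℝ φ (r * Complex.exp (θ * Complex.I)) = 0 := by
  obtain ⟨R, hR⟩ := (hc.fderiv ℝ).isCompact.isBounded.exists_norm_le
  refine ⟨R, fun r θ hr => image_eq_zero_of_notMem_tsupport fun hmem => ?_⟩
  have hnorm := hR _ hmem
  rw [norm_mul, Complex.norm_exp_ofReal_mul_I, mul_one, Complex.norm_real] at hnorm
  linarith [Real.le_norm_self r]

theorem smul_inv_smul_dbar_polarCoord_symm (φ : ℂ → E) {p : ℝ × ℝ} (hp : 0 < p.1) :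
    p.1 • ((Complex.polarCoord.symm p)⁻¹ • dbar φ (Complex.polarCoord.symm p))
      = fderiv ℝ φ (p.1 * Complex.exp (p.2 * Complex.I)) (Complex.exp (p.2 * Complex.I))
        + Complex.I • fderiv ℝ φ (p.1 * Complex.exp (p.2 * Complex.I))
          (Complex.exp (p.2 * Complex.I) * Complex.I) := by
  rw [Complex.polarCoord_symm_apply, Complex.ofReal_cos, Complex.ofReal_sin, ← Complex.exp_mul_I,
    ← exp_neg_smul_dbar, mul_inv, ← Complex.exp_neg, ← Complex.coe_smul, smul_smul,
    mul_inv_cancel_left₀ (Complex.ofReal_ne_zero.2 hp.ne')]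

variable [CompleteSpace E]

theorem integral_Ioi_fderiv_ray (hφ : ContDiff ℝ 1 φ) (hc : HasCompactSupport φ) (θ : ℝ) :
    ∫ r in Ioi (0 : ℝ), fderiv ℝ φ (r * Complex.exp (θ * Complex.I))
      (Complex.exp (θ * Complex.I)) = -φ 0 := by
  obtain ⟨R, hR⟩ := hc.isCompact.isBounded.exists_norm_le
  have hsupp : HasCompactSupport fun r : ℝ => φ (r * Complex.exp (θ * Complex.I)) := by
    refine HasCompactSupport.intro (isCompact_closedBall (0 : ℝ) R) fun r hr =>
      image_eq_zero_of_notMem_tsupport fun hmem => hr ?_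
    simpa [Complex.norm_exp_ofReal_mul_I] using hR _ hmem
  have hintegral := hsupp.integral_Ioi_deriv_eq
    (hφ.comp (Complex.ofRealCLM.contDiff.mul contDiff_const)) 0
  simpa [Function.comp_def, fun r => (hasDerivAt_comp_ray hφ r θ).deriv] using hintegral

theorem integral_fderiv_circle (hφ : ContDiff ℝ 1 φ) {r : ℝ} (hr : r ≠ 0) :
    ∫ θ in Ioo (-Real.pi) Real.pi, fderiv ℝ φ (r * Complex.exp (θ * Complex.I))
      (Complex.exp (θ * Complex.I) * Complex.I) = 0 := by
  have := hφ.continuous_fderiv one_ne_zero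
  have hintegral := intervalIntegral.integral_eq_sub_of_hasDerivAt (a := -Real.pi) (b := Real.pi)
    (fun θ _ => hasDerivAt_comp_circle hφ r θ) (Continuous.intervalIntegrable (by fun_prop) _ _)
  rw [intervalIntegral.integral_smul, Complex.ofReal_neg, neg_mul, Complex.exp_neg,
    Complex.exp_pi_mul_I, inv_neg, inv_one, sub_self, smul_eq_zero_iff_right hr,
    intervalIntegral.integral_of_le (by linarith [Real.pi_pos]),
    integral_Ioc_eq_integral_Ioo] at hintegral
  exact hintegral

theorem integral_inv_smul_dbar (hφ : ContDiff ℝ 1 φ) (hc : HasCompactSupport φ) :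
    ∫ w, w⁻¹ • dbar φ w = -(2 * Real.pi) • φ 0 := by
  let radial (p : ℝ × ℝ) : E :=
    fderiv ℝ φ (p.1 * Complex.exp (p.2 * Complex.I)) (Complex.exp (p.2 * Complex.I))
  let angular (p : ℝ × ℝ) : E :=
    fderiv ℝ φ (p.1 * Complex.exp (p.2 * Complex.I)) (Complex.exp (p.2 * Complex.I) * Complex.I)
  have := hφ.continuous_fderiv one_ne_zero
  obtain ⟨R, hR⟩ := exists_fderiv_polar_eq_zero hc
  have hradial : IntegrableOn radial (Ioi 0 ×ˢ Ioo (-Real.pi) Real.pi) :=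
    integrableOn_polar (by fun_prop) fun r θ (hr : R < r) => by
      simp only [radial, hR r θ hr, zero_apply]
  have hangular : IntegrableOn angular (Ioi 0 ×ˢ Ioo (-Real.pi) Real.pi) :=
    integrableOn_polar (by fun_prop) fun r θ (hr : R < r) => by
      simp only [angular, hR r θ hr, zero_apply]
  have hradial_eq : ∫ p in Ioi 0 ×ˢ Ioo (-Real.pi) Real.pi, radial p = -(2 * Real.pi) • φ 0 := by
    have hswap : IntegrableOn (fun p : ℝ × ℝ => radial p.swap)
        (Ioo (-Real.pi) Real.pi ×ˢ Ioi 0) (volume.prod volume) :=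
      IntegrableOn.swap hradial
    rw [Measure.volume_eq_prod, ← setIntegral_prod_swap, setIntegral_prod _ hswap]
    simp only [radial, Prod.fst_swap, Prod.snd_swap, integral_Ioi_fderiv_ray hφ hc,
      setIntegral_const, Real.volume_real_Ioo_of_le (neg_le_self Real.pi_pos.le)]
    rw [smul_neg, neg_smul, sub_neg_eq_add, two_mul]
  have hangular_eq : ∫ p in Ioi 0 ×ˢ Ioo (-Real.pi) Real.pi, angular p = 0 := by
    rw [Measure.volume_eq_prod, setIntegral_prod _ hangular]
    exact setIntegral_eq_zero_of_forall_eq_zero fun r hr => integral_fderiv_circle hφ (ne_of_gt hr)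
  calc ∫ w, w⁻¹ • dbar φ w
    _ = ∫ p in Ioi 0 ×ˢ Ioo (-Real.pi) Real.pi, (radial p + Complex.I • angular p) := by
      rw [← Complex.integral_comp_polarCoord_symm, polarCoord_target]
      exact setIntegral_congr_fun (measurableSet_Ioi.prod measurableSet_Ioo)
        fun p hp => smul_inv_smul_dbar_polarCoord_symm φ hp.1
    _ = -(2 * Real.pi) • φ 0 := by
      rw [integral_add (g := fun p => Complex.I • angular p) hradial (hangular.smul _),
        integral_smul, hradial_eq, hangular_eq, smul_zero, add_zero]

theorem integral_inv_sub_smul_dbar (hφ : ContDiff ℝ 1 φ) (hc : HasCompactSupport φ) (z : ℂ) :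
    ∫ w, (w - z)⁻¹ • dbar φ w = -(2 * Real.pi) • φ z := by
  have hdbar (w : ℂ) : dbar (fun w => φ (w + z)) w = dbar φ (w + z) := by
    simp only [dbar, fderiv_comp_add_right]
  have hpompeiu := integral_inv_smul_dbar (hφ.comp (contDiff_id.add (contDiff_const (c := z))))
    (hc.comp_homeomorph (Homeomorph.addRight z))
  rw [← integral_add_right_eq_self _ z]
  simpa [Function.comp_def, hdbar] using hpompeiu

end Pompeiu

/-! ### Runge's theorem on simply connected open sets -/

section FunctionalCalculus

theorem exists_contDiff_hasCompactSupport_eventuallyEq {E : Type*} [NormedAddCommGroup E]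
    [NormedSpace ℂ E] [CompleteSpace E] {f : ℂ → E} {C : Set ℂ} (hC : IsCompact C)
    (hf : AnalyticOnNhd ℂ f C) :
    ∃ φ : ℂ → E, ContDiff ℝ 1 φ ∧ HasCompactSupport φ ∧ ∀ z ∈ C, φ =ᶠ[𝓝 z] f := by
  obtain ⟨L, hL, hCL, hLf⟩ := exists_compact_between hC (isOpen_analyticAt ℂ f) hf
  obtain ⟨ψ, hψ_one, hψ_zero, -⟩ := exists_contMDiffMap_one_nhds_of_subset_interior (n := 1)
    (modelWithCornersSelf ℝ ℂ) hC.isClosed hCL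
  have hφ_zero (z : ℂ) (hz : z ∉ L) : ψ z • f z = 0 := by rw [hψ_zero z hz, zero_smul]
  refine ⟨fun z => ψ z • f z, ?_, .intro hL hφ_zero,
    fun z hz => ?_⟩
  · refine contMDiff_iff_contDiff.1 (contMDiff_of_tsupport fun z hz => ContDiffAt.contMDiffAt ?_)
    have hzL : z ∈ L :=
      closure_minimal (Function.support_subset_iff'.2 hφ_zero) hL.isClosed hz
    exact (contMDiff_iff_contDiff.1 ψ.contMDiff).contDiffAt.smul
      ((hLf hzL).contDiffAt.restrict_scalars ℝ)
  · filter_upwards [hψ_one.filter_mono (nhds_le_nhdsSet hz)] with w hw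
    rw [hw, one_smul]

variable {A : Type*} [NormedRing A] [NormedAlgebra ℂ A] {a : A}

theorem map_resolvent (χ : A →ₐ[ℂ] ℂ) {w : ℂ} (hw : w ∉ spectrum ℂ a) :
    χ (resolvent a w) = (w - χ a)⁻¹ := by
  have hinverse : resolvent a w * (algebraMap ℂ A w - a) = 1 :=
    Ring.inverse_mul_cancel _ (spectrum.notMem_iff.1 hw)
  apply_fun χ at hinverse
  rw [map_mul, map_one, map_sub, AlgHom.commutes, Algebra.algebraMap_self_apply] at hinverse
  exact eq_inv_of_mul_eq_one_left hinverse

variable [CompleteSpace A]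

theorem continuous_dbar_smul_resolvent {φ : ℂ → ℂ} (hφ : ContDiff ℝ 1 φ)
    (h₀ : ∀ z ∈ spectrum ℂ a, dbar φ =ᶠ[𝓝 z] 0) :
    Continuous fun w => dbar φ w • resolvent a w := by
  refine continuous_iff_continuousAt.2 fun w => ?_
  by_cases hw : w ∈ spectrum ℂ a
  · refine (continuousAt_const (y := (0 : A))).congr ?_
    filter_upwards [h₀ w hw] with z hz
    rw [hz, Pi.zero_apply, zero_smul]
  · exact (continuous_dbar hφ).continuousAt.smul (spectrum.hasDerivAt_resolvent_const_left
      (spectrum.mem_resolventSet_iff.2 (spectrum.notMem_iff.1 hw))).continuousAt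

theorem exists_forall_algHom_apply_eq {f : ℂ → ℂ} (hf : AnalyticOnNhd ℂ f (spectrum ℂ a)) :
    ∃ b : A, ∀ χ : A →ₐ[ℂ] ℂ, χ b = f (χ a) := by
  obtain ⟨φ, hφ, hφc, hφf⟩ :=
    exists_contDiff_hasCompactSupport_eventuallyEq (spectrum.isCompact a) hf
  have hdbar (z : ℂ) (hz : z ∈ spectrum ℂ a) : dbar φ =ᶠ[𝓝 z] 0 := by
    filter_upwards [eventually_eventually_nhds.2 (hφf z hz), (hf z hz).eventually_analyticAt]
      with w hw hfw
    exact dbar_eq_zero_of_differentiableAt (hfw.differentiableAt.congr_of_eventuallyEq hw)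
  -- The Cauchy integral of the resolvent, in the form given by Cauchy–Pompeiu.
  have hint : Integrable fun w => dbar φ w • resolvent a w :=
    (continuous_dbar_smul_resolvent hφ hdbar).integrable_of_hasCompactSupport
      (hasCompactSupport_dbar hφc).smul_right
  refine ⟨(-(2 * Real.pi))⁻¹ • ∫ w, dbar φ w • resolvent a w, fun χ => ?_⟩
  have hχ (w : ℂ) : χ (dbar φ w • resolvent a w) = (w - χ a)⁻¹ • dbar φ w := by
    by_cases hw : w ∈ spectrum ℂ a
    · rw [(hdbar w hw).self_of_nhds, Pi.zero_apply, zero_smul, smul_zero, map_zero]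
    · rw [map_smul, map_resolvent χ hw, smul_eq_mul, smul_eq_mul, mul_comm]
  have hpompeiu := integral_inv_sub_smul_dbar hφ hφc (χ a)
  rw [(hφf _ (AlgHom.apply_mem_spectrum χ a)).self_of_nhds] at hpompeiu
  have hχ_integral := χ.toContinuousLinearMap.integral_comp_comm hint
  simp only [AlgHom.coe_toContinuousLinearMap, hχ, hpompeiu] at hχ_integral
  rw [← Complex.coe_smul, map_smul, ← hχ_integral, Complex.coe_smul,
    inv_smul_smul₀ (neg_ne_zero.2 (by positivity))]

end FunctionalCalculus

section PolynomialHull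

/-- The uniform closure of the polynomials in `C(K, ℂ)`, a Banach algebra. -/
noncomputable abbrev polynomialClosure (K : Set ℂ) [CompactSpace K] : Subalgebra ℂ C(K, ℂ) :=
  (polynomialFunctions K).topologicalClosure

variable (K : Set ℂ) [CompactSpace K]

instance : IsClosed (polynomialClosure K : Set C(K, ℂ)) :=
  Subalgebra.isClosed_topologicalClosure _

instance : CompleteSpace (polynomialClosure K) :=
  IsClosed.completeSpace_coe (s := (polynomialClosure K : Set C(K, ℂ)))

/-- The coordinate function as an element of the closure of the polynomials. -/
noncomputable def polynomialClosure.X : polynomialClosure K :=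
  ⟨Polynomial.toContinuousMapOn Polynomial.X K,
    Subalgebra.le_topologicalClosure _ ⟨Polynomial.X, by simp⟩⟩

/-- The polynomially convex hull of `K`, as the spectrum of the coordinate function. -/
noncomputable def polynomialHull : Set ℂ :=
  spectrum ℂ (polynomialClosure.X K)

theorem isCompact_polynomialHull : IsCompact (polynomialHull K) :=
  spectrum.isCompact _

theorem spectrum_coe_polynomialClosure_X :
    spectrum ℂ (polynomialClosure.X K : C(K, ℂ)) = K := by
  rw [ContinuousMap.spectrum_eq_range]
  ext z
  simp [polynomialClosure.X]

theorem subset_polynomialHull : K ⊆ polynomialHull K := by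
  have hsubset := spectrum.subset_subalgebra (R := ℂ) (polynomialClosure.X K)
  rwa [spectrum_coe_polynomialClosure_X] at hsubset

theorem frontier_polynomialHull_subset : frontier (polynomialHull K) ⊆ K := by
  have hfrontier := Subalgebra.frontier_spectrum (𝕜 := ℂ) (polynomialClosure K)
    (polynomialClosure.X K)
  rwa [spectrum_coe_polynomialClosure_X] at hfrontier

variable {K}

theorem not_eq_sub_of_continuous_of_ne_zero {F : ℂ → ℂ} {w : ℂ} {r : ℝ} (hF : Continuous F)
    (hF₀ : ∀ z, F z ≠ 0) (hr : 0 < r) : ¬ ∀ z, ‖z - w‖ = r → F z = z - w := by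
  intro hF_circle
  have hsc : IsSimplyConnected (univ : Set ℂ) :=
    have := convex_univ.contractibleSpace (univ_nonempty (α := ℂ))
    (inferInstance : SimplyConnectedSpace (univ : Set ℂ))
  obtain ⟨G, hG, hGF⟩ := Complex.exists_continuousOn_eqOn_exp_comp hsc isOpen_univ
    hF.continuousOn (by simpa using hF₀)
  rw [continuousOn_univ] at hG
  -- A logarithm of `F` would give a continuous argument `θ + const` on the circle.
  let g (θ : ℝ) : ℂ := G (w + r * Complex.exp (θ * Complex.I)) - θ * Complex.I
  have hg_exp (θ : ℝ) : Complex.exp (g θ) = r := by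
    have hGF' : Complex.exp (G (w + r * Complex.exp (θ * Complex.I)))
        = F (w + r * Complex.exp (θ * Complex.I)) := hGF (mem_univ _)
    rw [Complex.exp_sub, hGF', hF_circle _ (by simp [Complex.norm_exp_ofReal_mul_I, hr.le]),
      add_sub_cancel_left, mul_div_cancel_right₀ _ (Complex.exp_ne_zero _)]
  have hg_const : g = fun _ => g 0 := Complex.isCoveringMap_exp.eq_of_comp_eq (by fun_prop)
    continuous_const (by ext θ; simp [hg_exp]) 0 rfl
  have hg_period := congrFun hg_const (2 * Real.pi)
  simp [g, Complex.exp_two_pi_mul_I] at hg_period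

theorem exists_continuousMap_forall_mem_exp_eq_sub {L Ω : Set ℂ} (hΩ : IsOpen Ω)
    (hsc : IsSimplyConnected Ω) (hL : IsClosed L) (hLΩ : L ⊆ Ω) {w : ℂ} (hw : w ∉ Ω) :
    ∃ H : C(ℂ, ℂ), ∀ z ∈ L, Complex.exp (H z) = z - w := by
  obtain ⟨H, hH, hHexp⟩ := Complex.exists_continuousOn_eqOn_exp_comp hsc hΩ (g := fun z => z - w)
    (by fun_prop) (by rintro ⟨z, hz, hzw⟩; exact hw (sub_eq_zero.1 hzw ▸ hz))
  obtain ⟨H', hH'⟩ := ContinuousMap.exists_restrict_eq (Y := ℂ) hL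
    ⟨L.domRestrict H, continuousOn_iff_continuous_domRestrict.1 (hH.mono hLΩ)⟩
  refine ⟨H', fun z hz => ?_⟩
  have hHz : H' z = H z := by simpa using DFunLike.congr_fun hH' ⟨z, hz⟩
  rw [hHz]
  exact hHexp (hLΩ hz)

theorem polynomialHull_subset {Ω : Set ℂ} (hΩ : IsOpen Ω) (hsc : IsSimplyConnected Ω)
    (hK : K ⊆ Ω) : polynomialHull K ⊆ Ω := by
  intro w hw
  by_contra hwΩ
  obtain ⟨H, hH⟩ := exists_continuousMap_forall_mem_exp_eq_sub hΩ hsc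
    (isCompact_iff_compactSpace.2 ‹_›).isClosed hK hwΩ
  classical
  -- The frontier of the hull lies in `K`, so that a logarithm of `z - w` on `K` extends `z - w`
  -- from the complement of the hull to the whole plane without zeros.
  let F : ℂ → ℂ := (polynomialHull K).piecewise (fun z => Complex.exp (H z)) (fun z => z - w)
  have hF : Continuous F := Continuous.piecewise
    (fun z hz => hH z (frontier_polynomialHull_subset K hz)) (by fun_prop) (by fun_prop)
  have hF₀ (z : ℂ) : F z ≠ 0 := by
    by_cases hz : z ∈ polynomialHull K
    · simp [F, hz]
    · simp only [F, hz, not_false_eq_true, piecewise_eq_of_notMem]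
      exact sub_ne_zero.2 fun hzw => hz (hzw ▸ hw)
  obtain ⟨r, hr₀, hr⟩ := (isCompact_polynomialHull K).isBounded.exists_pos_norm_le
  refine not_eq_sub_of_continuous_of_ne_zero hF hF₀ (w := w) (r := 2 * r + 1) (by positivity)
    fun z hz => piecewise_eq_of_notMem _ _ _ fun hzK => ?_
  linarith [norm_sub_le z w, hr z hzK, hr w hw]

theorem exists_polynomial_approx {f : ℂ → ℂ} (hf : AnalyticOnNhd ℂ f (polynomialHull K)) {ε : ℝ}
    (hε : 0 < ε) : ∃ p : Polynomial ℂ, ∀ z ∈ K, ‖p.eval z - f z‖ < ε := by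
  obtain ⟨b, hb⟩ := exists_forall_algHom_apply_eq hf
  obtain ⟨-, ⟨p, -, rfl⟩, hp⟩ := Metric.mem_closure_iff.1
    (show (b : C(K, ℂ)) ∈ closure (polynomialFunctions K : Set C(K, ℂ)) from b.2) ε hε
  refine ⟨p, fun z hz => ?_⟩
  have hbz : b.1 ⟨z, hz⟩ = f z := by
    refine (hb ((ContinuousMap.evalAlgHom ℂ ℂ (⟨z, hz⟩ : K)).comp (polynomialClosure K).val)).trans
      (congrArg f ?_)
    simp [polynomialClosure.X]
  rw [dist_comm] at hp
  simpa [← hbz, ← dist_eq_norm] using (ContinuousMap.dist_apply_le_dist (⟨z, hz⟩ : K)).trans_lt hp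

end PolynomialHull

/-! ### Homogeneous coordinates on the sphere -/

namespace RiemannSphere

/-- A finite point of the sphere. -/
def ofComplex (z : ℂ) : RiemannSphere := (some z : Option ℂ)

open Classical in
/-- The point of the sphere with homogeneous coordinates `v`; the junk value at `0` is `∞`. -/
noncomputable def proj (v : ℂ × ℂ) : RiemannSphere :=
  if v.2 = 0 then infty else ofComplex (v.1 / v.2)

/-- Homogeneous coordinates of a point of the sphere, normalised to `(z, 1)` at `z ∈ ℂ` and to
`(1, 0)` at `∞`. -/
def homogeneous : RiemannSphere → ℂ × ℂ
  | some z => (z, 1)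
  | none => (1, 0)

theorem proj_of_snd_eq_zero {v : ℂ × ℂ} (hv : v.2 = 0) : proj v = infty := if_pos hv

theorem proj_of_snd_ne_zero {v : ℂ × ℂ} (hv : v.2 ≠ 0) : proj v = ofComplex (v.1 / v.2) := if_neg hv

theorem proj_eq_infty_iff {v : ℂ × ℂ} : proj v = infty ↔ v.2 = 0 :=
  ⟨fun h => by_contra fun hv => Option.some_ne_none _ ((proj_of_snd_ne_zero hv).symm.trans h),
    proj_of_snd_eq_zero⟩

theorem toComplex_proj (v : ℂ × ℂ) : (proj v).toComplex = v.1 / v.2 := by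
  by_cases hv : v.2 = 0
  · rw [proj_of_snd_eq_zero hv, hv, div_zero]
    rfl
  · rw [proj_of_snd_ne_zero hv]
    rfl

theorem ofComplex_toComplex {p : RiemannSphere} (hp : p ≠ infty) : ofComplex p.toComplex = p := by
  rcases p with _ | z
  · exact absurd rfl hp
  · rfl

theorem exists_smul_homogeneous_proj {v : ℂ × ℂ} (hv : v ≠ 0) :
    ∃ a : ℂ, a ≠ 0 ∧ v = a • homogeneous (proj v) := by
  by_cases hv₂ : v.2 = 0
  · refine ⟨v.1, fun hv₁ => hv (Prod.ext hv₁ hv₂), ?_⟩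
    rw [proj_of_snd_eq_zero hv₂]
    ext <;> simp [homogeneous, infty, hv₂]
  · refine ⟨v.2, hv₂, ?_⟩
    rw [proj_of_snd_ne_zero hv₂]
    ext <;> simp [homogeneous, ofComplex, mul_div_cancel₀ _ hv₂]

theorem dist_eq_norm_wedge_homogeneous (p q : RiemannSphere) :
    dist p q = ‖wedge (homogeneous p) (homogeneous q)‖
      / (‖WithLp.toLp 2 (homogeneous p)‖ * ‖WithLp.toLp 2 (homogeneous q)‖) := by
  change chordal p q = _
  rcases p with _ | z <;> rcases q with _ | w <;>
    simp [chordal, homogeneous, wedge, WithLp.prod_norm_eq_of_L2, add_comm]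

theorem dist_proj {v w : ℂ × ℂ} (hv : v ≠ 0) (hw : w ≠ 0) :
    dist (proj v) (proj w) = ‖wedge v w‖ / (‖WithLp.toLp 2 v‖ * ‖WithLp.toLp 2 w‖) := by
  obtain ⟨a, ha, hav⟩ := exists_smul_homogeneous_proj hv
  obtain ⟨b, hb, hbw⟩ := exists_smul_homogeneous_proj hw
  have hwedge (x y : ℂ × ℂ) : wedge (a • x) (b • y) = a * b * wedge x y := by
    simp only [wedge, Prod.smul_fst, Prod.smul_snd, smul_eq_mul]
    ring
  conv_rhs => rw [hav, hbw]
  rw [hwedge, WithLp.toLp_smul, WithLp.toLp_smul, norm_smul, norm_smul, norm_mul, norm_mul,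
    mul_mul_mul_comm, mul_div_mul_left _ _ (by positivity), dist_eq_norm_wedge_homogeneous]

theorem continuousAt_proj {v : ℂ × ℂ} (hv : v ≠ 0) : ContinuousAt proj v := by
  refine tendsto_iff_dist_tendsto_zero.2 (Tendsto.congr' (f₁ := fun w : ℂ × ℂ =>
    ‖wedge w v‖ / (‖WithLp.toLp 2 w‖ * ‖WithLp.toLp 2 v‖)) ?_ ?_)
  · filter_upwards [eventually_ne_nhds hv] with w hw
    rw [dist_proj hw hv]
  · have hnorm : ‖WithLp.toLp 2 v‖ ≠ 0 := by simpa using hv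
    have hcont : ContinuousAt (fun w : ℂ × ℂ =>
        ‖wedge w v‖ / (‖WithLp.toLp 2 w‖ * ‖WithLp.toLp 2 v‖)) v := by
      unfold wedge
      exact ContinuousAt.div (by fun_prop)
        ((WithLp.prod_continuous_toLp 2 ℂ ℂ).norm.continuousAt.mul continuousAt_const)
        (mul_ne_zero hnorm hnorm)
    simpa [ContinuousAt, wedge, mul_comm] using hcont

theorem exists_forall_dist_proj_lt {X : Type*} [TopologicalSpace X] {v : X → ℂ × ℂ} {K : Set X}
    (hK : IsCompact K) (hv : ContinuousOn v K) (hv₀ : ∀ z ∈ K, v z ≠ 0) {ε : ℝ} (hε : 0 < ε) :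
    ∃ δ > 0, ∀ z ∈ K, ∀ w, dist w (v z) < δ → dist (proj w) (proj (v z)) < ε := by
  have huniform := (hK.image_of_continuousOn hv).uniformContinuousAt_of_continuousAt proj
    (forall_mem_image.2 fun z hz => continuousAt_proj (hv₀ z hz)) (dist_mem_uniformity hε)
  obtain ⟨δ, hδ, hsub⟩ := mem_uniformity_dist.1 huniform
  refine ⟨δ, hδ, fun z hz w hw => ?_⟩
  rw [dist_comm] at hw ⊢
  exact hsub hw (mem_image_of_mem v hz)

end RiemannSphere

/-! ### Locally univalent functions as curves in homogeneous coordinates -/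

open RiemannSphere

section Lift

theorem meromorphicOrderAt_eq_one_of_deriv_ne_zero {f : ℂ → ℂ} {z : ℂ} (hf : AnalyticAt ℂ f z)
    (hz : f z = 0) (hf' : deriv f z ≠ 0) : meromorphicOrderAt f z = 1 := by
  rw [hf.meromorphicOrderAt_eq, hf.analyticOrderAt_eq_one_of_zero_deriv_ne_zero hz hf']
  rfl

theorem meromorphicOrderAt_div_eq_neg_one {f g : ℂ → ℂ} {z : ℂ} (hf : AnalyticAt ℂ f z)
    (hg : AnalyticAt ℂ g z) (hfz : f z ≠ 0) (hgz : g z = 0) (hg' : deriv g z ≠ 0) :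
    meromorphicOrderAt (fun z => f z / g z) z = -1 := by
  have hf_order : meromorphicOrderAt f z = 0 := by
    rw [hf.meromorphicOrderAt_eq, hf.analyticOrderAt_eq_zero.2 hfz]
    rfl
  rw [← Pi.div_def, meromorphicOrderAt_div hf.meromorphicAt hg.meromorphicAt, hf_order,
    meromorphicOrderAt_eq_one_of_deriv_ne_zero hg hgz hg']
  rfl

theorem analyticAt_wedge {v w : ℂ → ℂ × ℂ} {z : ℂ} (hv : AnalyticAt ℂ v z)
    (hw : AnalyticAt ℂ w z) : AnalyticAt ℂ (fun z => wedge (v z) (w z)) z :=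
  ((analyticAt_fst.comp hv).mul (analyticAt_snd.comp hw)).sub
    ((analyticAt_snd.comp hv).mul (analyticAt_fst.comp hw))

variable {Ω : Opens ℂ}

theorem finitePart_of_mem (f : Ω → RiemannSphere) {z : ℂ} (hz : z ∈ Ω) :
    finitePart f z = (f ⟨z, hz⟩).toComplex := by
  simp [finitePart, hz]

theorem finitePart_proj_eventuallyEq (v : ℂ → ℂ × ℂ) (z : Ω) :
    finitePart (fun z : Ω => proj (v z)) =ᶠ[𝓝 (z : ℂ)] fun z => (v z).1 / (v z).2 := by
  filter_upwards [Ω.isOpen.mem_nhds z.2] with w hw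
  rw [finitePart_of_mem _ hw, toComplex_proj]

theorem exists_locallyUnivalentFunction_eq_proj {v : ℂ → ℂ × ℂ} (hv : AnalyticOnNhd ℂ v Ω)
    (hw : ∀ z ∈ Ω, wedge (v z) (deriv v z) ≠ 0) :
    ∃ f : LocallyUnivalentFunction Ω, ∀ z : Ω, f.1 z = proj (v z) := by
  let F (z : Ω) : RiemannSphere := proj (v z)
  have hF (z : Ω) : finitePart F =ᶠ[𝓝 (z : ℂ)] fun z => (v z).1 / (v z).2 :=
    finitePart_proj_eventuallyEq v z
  have hv₁ (z : Ω) : AnalyticAt ℂ (fun z => (v z).1) z := analyticAt_fst.comp (hv z z.2)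
  have hv₂ (z : Ω) : AnalyticAt ℂ (fun z => (v z).2) z := analyticAt_snd.comp (hv z z.2)
  have hv₁' (z : Ω) : HasDerivAt (fun z => (v z).1) (deriv v z).1 z :=
    hasDerivAt_fst_comp (hv z z.2).differentiableAt.hasDerivAt
  have hv₂' (z : Ω) : HasDerivAt (fun z => (v z).2) (deriv v z).2 z :=
    hasDerivAt_snd_comp (hv z z.2).differentiableAt.hasDerivAt
  have hfinite (z : Ω) (hz : F z ≠ infty) : (v z).2 ≠ 0 := fun h => hz (proj_eq_infty_iff.2 h)
  have horder (z : Ω) (hz : F z = infty) : meromorphicOrderAt (finitePart F) z = -1 := by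
    have hz₂ := proj_eq_infty_iff.1 hz
    have hwz := hw z z.2
    simp only [wedge, hz₂, zero_mul, sub_zero, mul_ne_zero_iff] at hwz
    rw [meromorphicOrderAt_congr ((hF z).filter_mono nhdsWithin_le_nhds)]
    exact meromorphicOrderAt_div_eq_neg_one (hv₁ z) (hv₂ z) hwz.1 hz₂ ((hv₂' z).deriv ▸ hwz.2)
  have hanalytic (z : Ω) (hz : F z ≠ infty) : AnalyticAt ℂ (finitePart F) z :=
    ((hv₁ z).div (hv₂ z) (hfinite z hz)).congr (hF z).symm
  have hmeromorphic (z : Ω) : MeromorphicAt (finitePart F) z :=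
    ((hv₁ z).meromorphicAt.div (hv₂ z).meromorphicAt).congr
      ((hF z).symm.filter_mono nhdsWithin_le_nhds)
  refine ⟨⟨⟨F, hanalytic, fun z hz => ⟨hmeromorphic z, ?_⟩⟩, fun z hz => (horder z hz).ge,
    fun z hz => ?_⟩, fun _ => rfl⟩
  · rw [horder z hz]
    decide
  · change deriv (finitePart F) z ≠ 0
    rw [(hF z).deriv_eq, ((hv₁' z).fun_div (hv₂' z) (hfinite z hz)).deriv]
    refine div_ne_zero (fun h => hw z z.2 ?_) (pow_ne_zero 2 (hfinite z hz))
    rw [wedge, ← neg_eq_zero, ← h]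
    ring

theorem MeromorphicFunction.meromorphicAt (g : MeromorphicFunction Ω) (z : Ω) :
    MeromorphicAt (finitePart g) z := by
  by_cases hz : g z = infty
  · exact (g.pole z hz).1
  · exact (g.analyticAt z hz).meromorphicAt

theorem MeromorphicFunction.finite_poles (g : MeromorphicFunction Ω) {H : Set ℂ} (hH : IsCompact H)
    (hHΩ : H ⊆ Ω) : {z ∈ H | ∃ h : z ∈ Ω, g ⟨z, h⟩ = infty}.Finite := by
  by_contra hinf
  obtain ⟨z, hzH, hz⟩ := Set.Infinite.exists_accPt_of_subset_isCompact hinf hH (sep_subset _ _)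
  obtain ⟨w, ⟨-, hwΩ, hw⟩, hwa⟩ := ((accPt_iff_frequently_nhdsNE.1 hz).and_eventually
    (g.meromorphicAt ⟨z, hHΩ hzH⟩).eventually_analyticAt).exists
  exact absurd hwa.meromorphicOrderAt_nonneg (not_le.2 (g.pole ⟨w, hwΩ⟩ hw).2)

theorem LocallyUnivalentFunction.meromorphicOrderAt_eq_neg_one (g : LocallyUnivalentFunction Ω)
    {z : Ω} (hz : g.1 z = infty) : meromorphicOrderAt (finitePart g.1) z = -1 := by
  have hneg := (g.1.pole z hz).2
  have hsimple : -1 ≤ meromorphicOrderAt (finitePart g.1) z := g.2.1 z hz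
  obtain ⟨n, hn⟩ := WithTop.ne_top_iff_exists.1 hneg.ne_top
  rw [← hn] at hneg hsimple ⊢
  exact congrArg _ (le_antisymm (Int.le_sub_one_of_lt (WithTop.coe_lt_coe.1 hneg))
    (WithTop.coe_le_coe.1 hsimple))

theorem deriv_prod_sub_ne_zero {P : Finset ℂ} {z : ℂ} (hz : z ∈ P) :
    deriv (fun w => ∏ p ∈ P, (w - p)) z ≠ 0 := by
  rw [(HasDerivAt.fun_finsetProd fun p _ => (hasDerivAt_id' z).sub_const p).deriv,
    Finset.sum_eq_single_of_mem z hz]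
  · simp only [smul_eq_mul, mul_one]
    exact Finset.prod_ne_zero_iff.2 fun p hp => sub_ne_zero.2 (Finset.ne_of_mem_erase hp).symm
  · intro p _ hpz
    rw [Finset.prod_eq_zero (Finset.mem_erase.2 ⟨hpz.symm, hz⟩) (sub_self z), zero_smul]

theorem toMeromorphicNFOn_eventuallyEq {f : ℂ → ℂ} {H : Set ℂ} (hf : MeromorphicOn f H) {z : ℂ}
    (hz : z ∈ H) (hfz : AnalyticAt ℂ f z) : toMeromorphicNFOn f H =ᶠ[𝓝 z] f :=
  ((meromorphicNFOn_toMeromorphicNFOn f H hz).eventuallyEq_nhdsNE_iff_eventuallyEq_nhds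
    hfz.meromorphicNFAt).1 (hf.toMeromorphicNFOn_eq_self_on_nhdsNE hz)

theorem toMeromorphicNFOn_analyticAt_and_ne_zero {f : ℂ → ℂ} {H : Set ℂ} (hf : MeromorphicOn f H)
    {z : ℂ} (hz : z ∈ H) (hfz : meromorphicOrderAt f z = 0) :
    AnalyticAt ℂ (toMeromorphicNFOn f H) z ∧ toMeromorphicNFOn f H z ≠ 0 := by
  have horder : meromorphicOrderAt (toMeromorphicNFOn f H) z = 0 := by
    rw [meromorphicOrderAt_congr (hf.toMeromorphicNFOn_eq_self_on_nhdsNE hz), hfz]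
  have hnormal := meromorphicNFOn_toMeromorphicNFOn f H hz
  exact ⟨hnormal.meromorphicOrderAt_nonneg_iff_analyticAt.1 horder.ge,
    hnormal.meromorphicOrderAt_eq_zero_iff.1 horder⟩

theorem wedge_deriv_mul_prodMk {f d : ℂ → ℂ} {z : ℂ} (hf : DifferentiableAt ℂ f z)
    (hd : DifferentiableAt ℂ d z) :
    wedge (f z * d z, d z) (deriv (fun z => (f z * d z, d z)) z) = -(deriv f z * d z ^ 2) := by
  rw [((hf.hasDerivAt.fun_mul hd.hasDerivAt).prodMk hd.hasDerivAt).deriv, wedge]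
  ring

/-- The curve `(f d, d)`, where `d` is the polynomial with simple zeros at the points of `P`, and
the removable singularities of `f d` in `H` have been removed: homogeneous coordinates near `H` of
a function `f` with simple poles in `P`. -/
noncomputable def clearPoles (f : ℂ → ℂ) (P : Finset ℂ) (H : Set ℂ) (z : ℂ) : ℂ × ℂ :=
  (toMeromorphicNFOn (fun z => f z * ∏ p ∈ P, (z - p)) H z, ∏ p ∈ P, (z - p))

section clearPoles

variable {f : ℂ → ℂ} {P : Finset ℂ} {H : Set ℂ} {z : ℂ}

theorem differentiable_prod_sub (P : Finset ℂ) :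
    Differentiable ℂ fun z => ∏ p ∈ P, (z - p) := by
  fun_prop

theorem clearPoles_of_pole (hf : MeromorphicOn f H) (hz : z ∈ H) (hzP : z ∈ P)
    (horder : meromorphicOrderAt f z = -1) :
    AnalyticAt ℂ (clearPoles f P H) z ∧
      wedge (clearPoles f P H z) (deriv (clearPoles f P H) z) ≠ 0 ∧
      proj (clearPoles f P H z) = infty := by
  have hd := (differentiable_prod_sub P).analyticAt
  have hdz : ∏ p ∈ P, (z - p) = 0 := Finset.prod_eq_zero hzP (sub_self z)
  have horder_mul : meromorphicOrderAt (fun z => f z * ∏ p ∈ P, (z - p)) z = 0 := by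
    rw [← Pi.mul_def, meromorphicOrderAt_mul (hf z hz) (hd z).meromorphicAt, horder,
      meromorphicOrderAt_eq_one_of_deriv_ne_zero (hd z) hdz (deriv_prod_sub_ne_zero hzP)]
    rfl
  obtain ⟨hanalytic, hne⟩ := toMeromorphicNFOn_analyticAt_and_ne_zero
    (hf.fun_mul fun z _ => (hd z).meromorphicAt) hz horder_mul
  have hderiv : deriv (clearPoles f P H) z = _ :=
    (hanalytic.differentiableAt.hasDerivAt.prodMk (hd z).differentiableAt.hasDerivAt).deriv
  refine ⟨hanalytic.prod (hd z), ?_, proj_of_snd_eq_zero hdz⟩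
  rw [hderiv, clearPoles, wedge, hdz, zero_mul, sub_zero]
  exact mul_ne_zero hne (deriv_prod_sub_ne_zero hzP)

theorem clearPoles_of_analyticAt (hf : MeromorphicOn f H) (hz : z ∈ H) (hzP : z ∉ P)
    (hfz : AnalyticAt ℂ f z) (hf' : deriv f z ≠ 0) :
    AnalyticAt ℂ (clearPoles f P H) z ∧
      wedge (clearPoles f P H z) (deriv (clearPoles f P H) z) ≠ 0 ∧
      proj (clearPoles f P H z) = ofComplex (f z) := by
  have hd := (differentiable_prod_sub P).analyticAt
  have hdz : ∏ p ∈ P, (z - p) ≠ 0 :=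
    Finset.prod_ne_zero_iff.2 fun p hp => sub_ne_zero.2 fun h => hzP (h ▸ hp)
  have heq : clearPoles f P H =ᶠ[𝓝 z] fun z => (f z * ∏ p ∈ P, (z - p), ∏ p ∈ P, (z - p)) :=
    (toMeromorphicNFOn_eventuallyEq (hf.fun_mul fun z _ => (hd z).meromorphicAt) hz
      (hfz.mul (hd z))).prodMk EventuallyEq.rfl
  refine ⟨((hfz.mul (hd z)).prod (hd z)).congr heq.symm, ?_, ?_⟩
  · rw [heq.deriv_eq, heq.eq_of_nhds,
      wedge_deriv_mul_prodMk hfz.differentiableAt (hd z).differentiableAt]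
    exact neg_ne_zero.2 (mul_ne_zero hf' (pow_ne_zero 2 hdz))
  · rw [heq.eq_of_nhds, proj_of_snd_ne_zero hdz, mul_div_cancel_right₀ _ hdz]

end clearPoles

theorem LocallyUnivalentFunction.exists_curve (g : LocallyUnivalentFunction Ω) {H : Set ℂ}
    (hH : IsCompact H) (hHΩ : H ⊆ Ω) :
    ∃ v : ℂ → ℂ × ℂ, AnalyticOnNhd ℂ v H ∧ (∀ z ∈ H, wedge (v z) (deriv v z) ≠ 0) ∧
      ∀ z : Ω, (z : ℂ) ∈ H → proj (v z) = g.1 z := by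
  let P := (g.1.finite_poles hH hHΩ).toFinset
  have hP (z : Ω) (hz : (z : ℂ) ∈ H) : (z : ℂ) ∈ P ↔ g.1 z = infty := by simp [P, hz]
  have hmeromorphic : MeromorphicOn (finitePart g.1) H := fun z hz => g.1.meromorphicAt ⟨z, hHΩ hz⟩
  have hcurve (z : Ω) (hz : (z : ℂ) ∈ H) : AnalyticAt ℂ (clearPoles (finitePart g.1) P H) z ∧
      wedge (clearPoles (finitePart g.1) P H z) (deriv (clearPoles (finitePart g.1) P H) z) ≠ 0 ∧
      proj (clearPoles (finitePart g.1) P H z) = g.1 z := by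
    by_cases hgz : g.1 z = infty
    · rw [hgz]
      exact clearPoles_of_pole hmeromorphic hz ((hP z hz).2 hgz)
        (g.meromorphicOrderAt_eq_neg_one hgz)
    · rw [← ofComplex_toComplex hgz, ← finitePart_of_mem g.1 z.2]
      exact clearPoles_of_analyticAt hmeromorphic hz (fun h => hgz ((hP z hz).1 h))
        (g.1.analyticAt z hgz) (g.2.2 z hgz)
  exact ⟨_, fun z hz => (hcurve ⟨z, hHΩ hz⟩ hz).1, fun z hz => (hcurve ⟨z, hHΩ hz⟩ hz).2.1,
    fun z hz => (hcurve z hz).2.2⟩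

theorem exists_coefficient_of_wedge_ne_zero {v : ℂ → ℂ × ℂ} {H : Set ℂ} (hv : AnalyticOnNhd ℂ v H)
    (hw : ∀ z ∈ H, wedge (v z) (deriv v z) ≠ 0) :
    ∃ c : ℂ → ℂ × ℂ, AnalyticOnNhd ℂ c H ∧ ∀ z ∈ H, HasDerivAt (fun z => (v z, deriv v z))
      (companion (ℂ × ℂ) (c z) (v z, deriv v z)) z := by
  refine ⟨fun z => cramerCoeff (v z, deriv v z) (deriv (deriv v) z), fun z hz => ?_,
    fun z hz => ?_⟩
  · have hv' := (hv z hz).deriv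
    exact ((analyticAt_wedge (hv z hz) hv'.deriv).div (analyticAt_wedge (hv z hz) hv')
      (hw z hz)).prod ((analyticAt_wedge hv'.deriv hv').div (analyticAt_wedge (hv z hz) hv')
      (hw z hz))
  · rw [companion_cramerCoeff (hw z hz)]
    exact (hv z hz).differentiableAt.hasDerivAt.prodMk
      (hv z hz).deriv.differentiableAt.hasDerivAt

end Lift

theorem dense_of_forall_exists_dist_lt {Ω : Opens ℂ} {S : Set (LocallyUnivalentFunction Ω)}
    (hS : ∀ (g : LocallyUnivalentFunction Ω) (K : Set ℂ), IsCompact K → K ⊆ Ω → ∀ ε > 0,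
      ∃ f ∈ S, ∀ z : Ω, (z : ℂ) ∈ K → dist (f.1 z) (g.1 z) < ε) : Dense S := by
  intro g
  have hbasis : (𝓝 (UniformOnFun.ofFun {K : Set Ω | IsCompact K} g.1.toFun)).HasBasis _ _ :=
    UniformOnFun.hasBasis_nhds_of_basis Ω RiemannSphere {K : Set Ω | IsCompact K}
      (UniformOnFun.ofFun {K : Set Ω | IsCompact K} g.1.toFun) ⟨∅, isCompact_empty⟩
      (directedOn_of_sup_mem fun _ _ hK hL => hK.union hL) uniformity_basis_dist
  refine mem_closure_iff_nhds.2 fun t ht => ?_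
  rw [nhds_subtype_eq_comap, nhds_induced] at ht
  obtain ⟨⟨K, ε⟩, ⟨hK, hε⟩, hsub⟩ := ((hbasis.comap _).comap _).mem_iff.1 ht
  obtain ⟨f, hfS, hf⟩ := hS g (Subtype.val '' K) (hK.image continuous_subtype_val)
    (by rintro _ ⟨z, -, rfl⟩; exact z.2) ε hε
  exact ⟨f, hsub fun z hz => hf z ⟨z, hz, rfl⟩, hfS⟩

/-! ### Approximation by entire solutions -/

section ConnectedNeighborhood

variable {X : Type*} [TopologicalSpace X] [LocallyConnectedSpace X] [LocallyCompactSpace X]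
  {Ω : Set X}

theorem exists_isOpen_isPreconnected_isCompact_superset {x : X} (hΩ : Ω ∈ 𝓝 x) :
    ∃ U L, IsOpen U ∧ IsPreconnected U ∧ x ∈ U ∧ U ⊆ L ∧ IsCompact L ∧ L ⊆ Ω := by
  obtain ⟨L, hL, hLΩ, hLc⟩ := local_compact_nhds hΩ
  obtain ⟨U, hUL, hU, hxU, hUc⟩ := locallyConnectedSpace_iff_subsets_isOpen_isConnected.1 ‹_› x L hL
  exact ⟨U, L, hU, hUc.isPreconnected, hxU, hUL, hLc, hLΩ⟩

theorem exists_isOpen_isPreconnected_of_mem (hΩ : IsOpen Ω) (hΩc : IsPreconnected Ω) {x y : X}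
    (hx : x ∈ Ω) (hy : y ∈ Ω) :
    ∃ U L, IsOpen U ∧ IsPreconnected U ∧ x ∈ U ∧ y ∈ U ∧ U ⊆ L ∧ IsCompact L ∧ L ⊆ Ω := by
  refine hΩc.induction₂ (fun x y => ∃ U L, IsOpen U ∧ IsPreconnected U ∧ x ∈ U ∧ y ∈ U ∧ U ⊆ L ∧
    IsCompact L ∧ L ⊆ Ω) (fun x hx => ?_) ?_ ?_ hx hy
  · obtain ⟨U, L, hU, hUc, hxU, hUL, hL, hLΩ⟩ :=
      exists_isOpen_isPreconnected_isCompact_superset (hΩ.mem_nhds hx)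
    filter_upwards [mem_nhdsWithin_of_mem_nhds (hU.mem_nhds hxU)] with y hy
    exact ⟨U, L, hU, hUc, hxU, hy, hUL, hL, hLΩ⟩
  · rintro x y z - _ - ⟨U, L, hU, hUc, hxU, hyU, hUL, hL, hLΩ⟩
      ⟨V, M, hV, hVc, hyV, hzV, hVM, hM, hMΩ⟩
    exact ⟨U ∪ V, L ∪ M, hU.union hV, hUc.union y hyU hyV hVc, .inl hxU, .inr hzV,
      union_subset_union hUL hVM, hL.union hM, union_subset hLΩ hMΩ⟩
  · rintro x y - - ⟨U, L, hU, hUc, hxU, hyU, h⟩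
    exact ⟨U, L, hU, hUc, hyU, hxU, h⟩

theorem exists_isOpen_isPreconnected_between {K : Set X} (hK : IsCompact K)
    (hΩ : IsOpen Ω) (hΩc : IsConnected Ω) (hKΩ : K ⊆ Ω) :
    ∃ U L, IsOpen U ∧ IsPreconnected U ∧ U.Nonempty ∧ K ⊆ U ∧ U ⊆ L ∧ IsCompact L ∧ L ⊆ Ω := by
  obtain ⟨⟨x, hx⟩, hΩc⟩ := hΩc
  suffices ∃ U L, IsOpen U ∧ IsPreconnected U ∧ x ∈ U ∧ K ⊆ U ∧ U ⊆ L ∧ IsCompact L ∧ L ⊆ Ω by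
    obtain ⟨U, L, hU, hUc, hxU, h⟩ := this
    exact ⟨U, L, hU, hUc, ⟨x, hxU⟩, h⟩
  refine hK.induction_on ?_ ?_ ?_ fun y hy => ?_
  · obtain ⟨U, L, hU, hUc, hxU, h⟩ :=
      exists_isOpen_isPreconnected_isCompact_superset (hΩ.mem_nhds hx)
    exact ⟨U, L, hU, hUc, hxU, empty_subset U, h⟩
  · rintro S T hST ⟨U, L, hU, hUc, hxU, hTU, h⟩
    exact ⟨U, L, hU, hUc, hxU, hST.trans hTU, h⟩
  · rintro S T ⟨U, L, hU, hUc, hxU, hSU, hUL, hL, hLΩ⟩ ⟨V, M, hV, hVc, hxV, hTV, hVM, hM, hMΩ⟩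
    exact ⟨U ∪ V, L ∪ M, hU.union hV, hUc.union x hxU hxV hVc, .inl hxU,
      union_subset_union hSU hTV, union_subset_union hUL hVM, hL.union hM, union_subset hLΩ hMΩ⟩
  · obtain ⟨U, L, hU, hUc, hxU, hyU, h⟩ :=
      exists_isOpen_isPreconnected_of_mem hΩ hΩc hx (hKΩ hy)
    exact ⟨U, mem_nhdsWithin_of_mem_nhds (hU.mem_nhds hyU), U, L, hU, hUc, hxU, subset_rfl, h⟩

end ConnectedNeighborhood

theorem exists_seq_polynomial_tendstoUniformlyOn {K : Set ℂ} [CompactSpace K] {c : ℂ → ℂ × ℂ}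
    (hc : AnalyticOnNhd ℂ c (polynomialHull K)) :
    ∃ P Q : ℕ → Polynomial ℂ,
      TendstoUniformlyOn (fun n z => ((P n).eval z, (Q n).eval z)) c atTop K := by
  have hpos (n : ℕ) : (0 : ℝ) < 1 / (n + 1) := Nat.one_div_pos_of_nat
  have hp : AnalyticOnNhd ℂ (fun z => (c z).1) (polynomialHull K) := fun z hz =>
    analyticAt_fst.comp (hc z hz)
  have hq : AnalyticOnNhd ℂ (fun z => (c z).2) (polynomialHull K) := fun z hz =>
    analyticAt_snd.comp (hc z hz)
  choose P hP using fun n => exists_polynomial_approx hp (hpos n)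
  choose Q hQ using fun n => exists_polynomial_approx hq (hpos n)
  refine ⟨P, Q, Metric.tendstoUniformlyOn_iff.2 fun δ hδ => ?_⟩
  filter_upwards [(tendsto_order.1 tendsto_one_div_add_atTop_nhds_zero_nat).2 δ hδ] with n hn z hz
  rw [dist_comm, dist_eq_norm]
  exact max_lt ((hP n z hz).trans hn) ((hQ n z hz).trans hn)

theorem LocallyUnivalentFunction.exists_entire_approx {Ω : Opens ℂ}
    (hΩ : IsSimplyConnected (Ω : Set ℂ)) (g : LocallyUnivalentFunction Ω) {K : Set ℂ}
    (hK : IsCompact K) (hKΩ : K ⊆ Ω) {ε : ℝ} (hε : 0 < ε) :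
    ∃ (c : ℂ → ℂ × ℂ) (u : ℂ → (ℂ × ℂ) × (ℂ × ℂ)), Differentiable ℂ c ∧ IsSolution c u ∧
      (∀ z, wedge (u z).1 (u z).2 ≠ 0) ∧
      ∀ z : Ω, (z : ℂ) ∈ K → dist (proj (u z).1) (g.1 z) < ε := by
  obtain ⟨U, L, hU, hUc, ⟨z₀, hz₀⟩, hKU, hUL, hL, hLΩ⟩ :=
    exists_isOpen_isPreconnected_between hK Ω.isOpen hΩ.isPathConnected.isConnected hKΩ
  have : CompactSpace L := isCompact_iff_compactSpace.1 hL
  have hULH := hUL.trans (subset_polynomialHull L)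
  obtain ⟨v, hv, hw, hg⟩ := g.exists_curve (isCompact_polynomialHull L)
    (polynomialHull_subset Ω.isOpen hΩ hLΩ)
  obtain ⟨c, hc, hvc⟩ := exists_coefficient_of_wedge_ne_zero hv hw
  obtain ⟨P, Q, hPQ⟩ := exists_seq_polynomial_tendstoUniformlyOn hc
  have hentire (n : ℕ) : Differentiable ℂ fun z => ((P n).eval z, (Q n).eval z) :=
    (P n).differentiable.prodMk (Q n).differentiable
  choose u hu hu₀ using fun n => exists_isSolution (hentire n) z₀ (v z₀, deriv v z₀)
  have hlim : TendstoUniformlyOn u (fun z => (v z, deriv v z)) atTop K :=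
    (tendstoLocallyUniformlyOn_iff_forall_isCompact hU).1
      (tendstoLocallyUniformlyOn_of_hasDerivAt hU hUc
        (uniformContinuous_companion.continuous.comp_continuousOn (hc.continuousOn.mono hULH))
        (fun z hz => hvc z (hULH hz)) (fun n z _ => hu n z)
        (uniformContinuous_companion.comp_tendstoUniformlyOn
          (hPQ.mono hUL)).tendstoLocallyUniformlyOn hz₀ (by simp only [hu₀, tendsto_const_nhds]))
      K hKU hK
  obtain ⟨δ, hδ, hproj⟩ := exists_forall_dist_proj_lt hK
    (hv.continuousOn.mono (hKU.trans hULH))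
    (fun z hz => ne_zero_of_wedge_ne_zero (hw z (hULH (hKU hz)))) hε
  obtain ⟨n, hn⟩ := (Metric.tendstoUniformlyOn_iff.1 hlim δ hδ).exists
  refine ⟨_, u n, hentire n, hu n, (hu n).wedge_ne_zero (hentire n)
    (by rw [hu₀]; exact hw z₀ (hULH hz₀)), fun z hz => ?_⟩
  rw [← hg z (hULH (hKU hz))]
  exact hproj z hz _ ((le_max_left _ _).trans_lt (dist_comm (u n z) (v z, deriv v z) ▸ hn z hz))

/-! ### Gaussian approximation -/

section GaussKernel

/-- The Gaussian kernel on the complex plane, normalized to have integral `1` along horizontal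
lines. -/
noncomputable def gaussKernel (b : ℝ) (z : ℂ) : ℂ := √(b / Real.pi) * Complex.exp (-b * z ^ 2)

theorem differentiable_gaussKernel (b : ℝ) : Differentiable ℂ (gaussKernel b) := by
  unfold gaussKernel
  fun_prop

theorem integral_gaussKernel {b : ℝ} (hb : 0 < b) (z : ℂ) : ∫ t : ℝ, gaussKernel b (z - t) = 1 := by
  have : (b : ℂ) ≠ 0 := by exact_mod_cast hb.ne'
  calc ∫ t : ℝ, gaussKernel b (z - t)
      = √(b / Real.pi) *
        ∫ t : ℝ, Complex.exp (-b * t ^ 2 + 2 * b * z * t + -b * z ^ 2) := by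
        rw [← integral_const_mul]
        refine integral_congr_ae (.of_forall fun t => ?_)
        simp only [gaussKernel]
        congr 2
        ring
    _ = √(b / Real.pi) * √(Real.pi / b) := by
        rw [integral_cexp_quadratic (by simpa using hb),
          show (-b * z ^ 2 - (2 * b * z) ^ 2 / (4 * -b) : ℂ) = 0 by field_simp; ring,
          Complex.exp_zero, mul_one, neg_neg, Real.sqrt_eq_rpow (Real.pi / b),
          Complex.ofReal_cpow (by positivity)]
        push_cast
        rfl
    _ = 1 := by
        rw [← Complex.ofReal_mul, ← Real.sqrt_mul (by positivity),
          div_mul_div_cancel₀ Real.pi_ne_zero, div_self hb.ne', Real.sqrt_one, Complex.ofReal_one]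

theorem integrable_gaussKernel {b : ℝ} (hb : 0 < b) (z : ℂ) :
    Integrable fun t : ℝ => gaussKernel b (z - t) := by
  by_contra h
  exact zero_ne_one ((integral_undef h).symm.trans (integral_gaussKernel hb z))

theorem norm_gaussKernel_sub_le {b t : ℝ} {z : ℂ} (hb : 0 ≤ b) (hz : 2 * |z.im| ≤ |t - z.re|) :
    ‖gaussKernel b (z - t)‖ ≤
      √(b / Real.pi) * Real.exp (-(b / 2) * (t - z.re) ^ 2) *
        Real.exp (-(b / 4 * (t - z.re) ^ 2)) := by
  have him : 4 * z.im ^ 2 ≤ (t - z.re) ^ 2 := by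
    rw [← sq_abs z.im, ← sq_abs (t - z.re)]
    nlinarith [abs_nonneg z.im]
  have hre : (-b * (z - t) ^ 2 : ℂ).re = -(b * ((t - z.re) ^ 2 - z.im ^ 2)) := by
    simp only [pow_two, neg_mul, Complex.neg_re, Complex.mul_re,
      Complex.sub_re, Complex.sub_im, Complex.ofReal_re, Complex.ofReal_im]
    ring
  rw [gaussKernel, norm_mul, Complex.norm_real, Real.norm_of_nonneg (Real.sqrt_nonneg _),
    Complex.norm_exp, hre, mul_assoc, ← Real.exp_add]
  gcongr
  nlinarith

theorem integral_gaussian_majorant {b : ℝ} (hb : 0 < b) (x : ℝ) :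
    ∫ t : ℝ, √(b / Real.pi) * Real.exp (-(b / 2) * (t - x) ^ 2) = √2 := by
  rw [integral_const_mul, integral_sub_right_eq_self (fun t => Real.exp (-(b / 2) * t ^ 2)),
    integral_gaussian, ← Real.sqrt_mul (by positivity)]
  congr 1
  field_simp

end GaussKernel

theorem exp_neg_mul_add_mul_le {k τ C x : ℝ} (hk : 0 < k) (hτ : 0 ≤ τ) (hC : 0 ≤ C)
    (hx : 0 ≤ x) : Real.exp (-(k * x)) * (τ + C * x) ≤ τ + C / k := by
  have hexp : Real.exp (-(k * x)) ≤ 1 := Real.exp_le_one_iff.2 (by nlinarith)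
  have hmul : Real.exp (-(k * x)) * x ≤ 1 / k := by
    rw [le_div_iff₀ hk, Real.exp_neg, mul_assoc, inv_mul_le_one₀ (Real.exp_pos _), mul_comm]
    linarith [Real.add_one_le_exp (k * x)]
  calc Real.exp (-(k * x)) * (τ + C * x)
      = Real.exp (-(k * x)) * τ + C * (Real.exp (-(k * x)) * x) := by ring
    _ ≤ 1 * τ + C * (1 / k) := by gcongr
    _ = τ + C / k := by ring

theorem exists_dist_le_add_mul_sq {α β : Type*} [PseudoMetricSpace α] [PseudoMetricSpace β]
    {f : α → β} (hf : UniformContinuous f) (hbdd : Bornology.IsBounded (range f)) {ε : ℝ}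
    (hε : 0 < ε) : ∃ C ≥ 0, ∀ s t, dist (f s) (f t) ≤ ε + C * dist s t ^ 2 := by
  obtain ⟨M, hM⟩ := isBounded_range_iff.1 hbdd
  obtain ⟨δ, hδ, hfδ⟩ := Metric.uniformContinuous_iff.1 hf ε hε
  refine ⟨|M| / δ ^ 2, by positivity, fun s t => ?_⟩
  rcases lt_or_ge (dist s t) δ with hst | hst
  · exact (hfδ hst).le.trans (le_add_of_nonneg_right (by positivity))
  · calc dist (f s) (f t) ≤ |M| / δ ^ 2 * δ ^ 2 := by
          rw [div_mul_cancel₀ _ (by positivity)]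
          exact (hM s t).trans (le_abs_self M)
      _ ≤ ε + |M| / δ ^ 2 * dist s t ^ 2 := le_add_of_nonneg_of_le hε.le (by gcongr)

section GaussDomain

variable {E : Type*}

/-- The points `z` such that `ψ` is constant at distance less than `2 |im z|` from `re z`; there,
the exponential growth of the Gaussian kernel in the imaginary direction is harmless. -/
def gaussDomain (ψ : ℝ → E) : Set ℂ := {z | ∀ t, ψ t ≠ ψ z.re → 2 * |z.im| ≤ |t - z.re|}

theorem ofReal_mem_gaussDomain (ψ : ℝ → E) (t : ℝ) : (t : ℂ) ∈ gaussDomain ψ := by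
  simp [gaussDomain]

theorem closedBall_subset_gaussDomain {ψ : ℝ → E} {a R : ℝ} {v : E}
    (hψ : ∀ t ∈ closedBall a (3 * R), ψ t = v) :
    closedBall (a : ℂ) R ⊆ gaussDomain ψ ∩ {z | ψ z.re = v} := by
  intro z hz
  rw [mem_closedBall, dist_eq_norm] at hz
  have hre := (Complex.abs_re_le_norm (z - a)).trans hz
  have him := (Complex.abs_im_le_norm (z - a)).trans hz
  simp only [Complex.sub_re, Complex.ofReal_re, Complex.sub_im, Complex.ofReal_im,
    sub_zero] at hre him
  have hψz : ψ z.re = v := hψ _ (hre.trans (by linarith [abs_nonneg (z.re - a)]))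
  refine ⟨fun t ht => ?_, hψz⟩
  have ht' : 3 * R < |t - a| := lt_of_not_ge fun h => ht ((hψ t h).trans hψz.symm)
  linarith [abs_sub_le t z.re a]

end GaussDomain

section GaussConv

variable {E : Type*} [NormedAddCommGroup E] [NormedSpace ℂ E] {ψ : ℝ → E}

/-- The convolution of `ψ` with the Gaussian kernel, extended to the complex plane. -/
noncomputable def gaussConv (ψ : ℝ → E) (b : ℝ) (z : ℂ) : E := ∫ t : ℝ, gaussKernel b (z - t) • ψ t

theorem integrable_gaussKernel_smul (hψ : Continuous ψ) (hc : HasCompactSupport ψ) (b : ℝ)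
    (z : ℂ) : Integrable fun t : ℝ => gaussKernel b (z - t) • ψ t := by
  have := (differentiable_gaussKernel b).continuous
  exact Continuous.integrable_of_hasCompactSupport (by fun_prop) hc.smul_left

theorem differentiable_gaussConv (hψ : Continuous ψ) (hc : HasCompactSupport ψ) (b : ℝ) :
    Differentiable ℂ (gaussConv ψ b) := by
  intro z₀
  have hK := differentiable_gaussKernel b
  have hK' : Continuous (deriv (gaussKernel b)) := (hK.contDiff (n := 1)).continuous_deriv le_rfl
  have hcont : Continuous fun p : ℂ × ℝ => deriv (gaussKernel b) (p.1 - p.2) • ψ p.2 := by fun_prop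
  obtain ⟨C, hC⟩ := ((isCompact_closedBall z₀ 1).prod
    (show IsCompact (tsupport ψ) from hc)).exists_bound_of_continuousOn hcont.continuousOn
  refine (hasDerivAt_integral_of_dominated_loc_of_deriv_le (𝕜 := ℂ)
    (F' := fun z t => deriv (gaussKernel b) (z - t) • ψ t)
    (bound := (tsupport ψ).indicator fun _ => C) (closedBall_mem_nhds z₀ one_pos)
    (.of_forall fun z => (integrable_gaussKernel_smul hψ hc b z).aestronglyMeasurable)
    (integrable_gaussKernel_smul hψ hc b z₀)
    (Continuous.aestronglyMeasurable (by fun_prop)) (.of_forall fun t z hz => ?_)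
    ((integrable_indicator_iff (isClosed_tsupport ψ).measurableSet).2
      (integrableOn_const hc.measure_lt_top.ne))
    (.of_forall fun t z _ => ?_)).2.differentiableAt
  · by_cases ht : t ∈ tsupport ψ
    · rw [indicator_of_mem ht]
      exact hC (z, t) ⟨hz, ht⟩
    · rw [indicator_of_notMem ht, image_eq_zero_of_notMem_tsupport ht, smul_zero, norm_zero]
  · exact ((hK (z - t)).hasDerivAt.comp_sub_const z t).smul_const (ψ t)

theorem gaussConv_sub [CompleteSpace E] {b : ℝ} (hb : 0 < b) (hψ : Continuous ψ)
    (hc : HasCompactSupport ψ) (z : ℂ) (a : E) :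
    gaussConv ψ b z - a = ∫ t : ℝ, gaussKernel b (z - t) • (ψ t - a) := by
  simp only [smul_sub]
  rw [integral_sub (integrable_gaussKernel_smul hψ hc b z)
    ((integrable_gaussKernel hb z).smul_const a), integral_smul_const, integral_gaussKernel hb,
    one_smul, gaussConv]

theorem norm_gaussConv_sub_le [CompleteSpace E] {b τ C : ℝ} {z : ℂ} {a : E} (hb : 0 < b)
    (hψ : Continuous ψ) (hc : HasCompactSupport ψ) (hτ : 0 ≤ τ) (hC : 0 ≤ C)
    (hψa : ∀ t, ‖ψ t - a‖ ≤ τ + C * (t - z.re) ^ 2)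
    (hz : ∀ t, ψ t ≠ a → 2 * |z.im| ≤ |t - z.re|) :
    ‖gaussConv ψ b z - a‖ ≤ √2 * (τ + C / (b / 4)) := by
  have hbound (t : ℝ) : ‖gaussKernel b (z - t) • (ψ t - a)‖ ≤
      √(b / Real.pi) * Real.exp (-(b / 2) * (t - z.re) ^ 2) * (τ + C / (b / 4)) := by
    by_cases ht : ψ t = a
    · rw [ht, sub_self, smul_zero, norm_zero]
      positivity
    · calc ‖gaussKernel b (z - t) • (ψ t - a)‖
          ≤ √(b / Real.pi) * Real.exp (-(b / 2) * (t - z.re) ^ 2) *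
              Real.exp (-(b / 4 * (t - z.re) ^ 2)) * (τ + C * (t - z.re) ^ 2) := by
            rw [norm_smul]
            gcongr
            exacts [norm_gaussKernel_sub_le hb.le (hz t ht), hψa t]
        _ ≤ _ := by
            rw [mul_assoc]
            gcongr
            exact exp_neg_mul_add_mul_le (by positivity) hτ hC (sq_nonneg _)
  rw [gaussConv_sub hb hψ hc, ← integral_gaussian_majorant hb z.re, ← integral_mul_const]
  refine norm_integral_le_of_norm_le (Integrable.mul_const (.const_mul ?_ _) _) (.of_forall hbound)
  exact (integrable_exp_neg_mul_sq (half_pos hb)).comp_sub_right z.re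

theorem tendstoUniformlyOn_gaussConv [CompleteSpace E] (hψ : Continuous ψ)
    (hc : HasCompactSupport ψ) :
    TendstoUniformlyOn (gaussConv ψ) (fun z => ψ z.re) atTop (gaussDomain ψ) := by
  refine Metric.tendstoUniformlyOn_iff.2 fun ε hε => ?_
  obtain ⟨C, hC, hψC⟩ := exists_dist_le_add_mul_sq (hc.uniformContinuous_of_continuous hψ)
    (hc.isCompact_range hψ).isBounded (by positivity : 0 < ε / 4)
  simp only [dist_eq_norm, Real.norm_eq_abs, sq_abs] at hψC
  have hlim : Tendsto (fun b : ℝ => C / (b / 4)) atTop (𝓝 0) :=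
    (tendsto_id.atTop_div_const four_pos).const_div_atTop C
  filter_upwards [eventually_gt_atTop 0, (tendsto_order.1 hlim).2 (ε / 4) (by positivity)]
    with b hb hbε z hz
  rw [dist_comm, dist_eq_norm]
  calc ‖gaussConv ψ b z - ψ z.re‖ ≤ √2 * (ε / 4 + C / (b / 4)) :=
        norm_gaussConv_sub_le hb hψ hc (by positivity) hC (fun t => hψC t z.re) hz
    _ ≤ 3 / 2 * (ε / 4 + C / (b / 4)) := by
        gcongr
        exact (Real.sqrt_le_left (by norm_num)).2 (by norm_num)
    _ < ε := by linarith

end GaussConv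

/-! ### Connecting two equations along a real segment -/

section Jet

variable {K : Type*} [Field K]

/-- The second order jet of a polynomial at a point. -/
noncomputable def jet (P : Polynomial K) (z : K) : K × K × K :=
  (P.eval z, P.derivative.eval z, P.derivative.derivative.eval z)

theorem jet_eq_of_dvd_sub {P Q : Polynomial K} {z : K}
    (h : (.X - .C z) ^ 3 ∣ P - Q) : jet P z = jet Q z := by
  obtain ⟨W, hW⟩ := h
  rw [sub_eq_iff_eq_add.1 hW]
  ext <;> simp [jet, Polynomial.derivative_pow]

theorem exists_jet_eq [NeZero (2 : K)] (z : K) (p : K × K × K) :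
    ∃ P : Polynomial K, jet P z = p := by
  refine ⟨.C p.1 + .C p.2.1 * (.X - .C z) + .C (p.2.2 / 2) * (.X - .C z) ^ 2, ?_⟩
  ext <;> simp [jet, Polynomial.derivative_pow, NeZero.ne]

theorem exists_jet_eq_and_jet_eq [NeZero (2 : K)] {a b : K} (hab : a ≠ b) (p q : K × K × K) :
    ∃ P : Polynomial K, jet P a = p ∧ jet P b = q := by
  obtain ⟨u, v, huv⟩ := (Polynomial.isCoprime_X_sub_C_of_isUnit_sub
    (sub_ne_zero.2 hab).isUnit).pow (m := 3) (n := 3)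
  obtain ⟨A, hA⟩ := exists_jet_eq a p
  obtain ⟨B, hB⟩ := exists_jet_eq b q
  refine ⟨A + (B - A) * u * (.X - .C a) ^ 3,
    (jet_eq_of_dvd_sub ⟨(B - A) * u, by ring⟩).trans hA,
    (jet_eq_of_dvd_sub ⟨(A - B) * v, ?_⟩).trans hB⟩
  linear_combination (B - A) * huv

theorem jet_comp_of_dvd_sub (P : Polynomial K) {Q : Polynomial K} {z : K}
    (h : (.X - .C z) ^ 3 ∣ Q - .X) : jet (P.comp Q) z = jet P z := by
  refine jet_eq_of_dvd_sub (h.trans ?_)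
  have hdvd : Q - .X ∣ (P.map Polynomial.C).eval Q - (P.map Polynomial.C).eval .X :=
    Polynomial.sub_dvd_eval_sub ..
  rwa [Polynomial.eval_map, Polynomial.eval_map, Polynomial.eval₂_C_X] at hdvd

end Jet

section GraphPolynomial

open Polynomial

/-- The parametrization `t ↦ t + i q(t)` of the graph of a real polynomial `q` over the real
line. -/
noncomputable def graphPolynomial (q : ℝ[X]) : ℂ[X] := X + C Complex.I * q.map Complex.ofRealHom

theorem eval_ofReal_graphPolynomial (q : ℝ[X]) (t : ℝ) :
    (graphPolynomial q).eval (t : ℂ) = ⟨t, q.eval t⟩ := by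
  have hq : (q.map Complex.ofRealHom).eval (t : ℂ) = (q.eval t : ℝ) :=
    eval_map_apply Complex.ofRealHom t
  rw [graphPolynomial, eval_add, eval_mul, eval_X, eval_C, hq, mul_comm, ← Complex.mk_eq_add_mul_I]

theorem derivative_graphPolynomial (q : ℝ[X]) :
    derivative (graphPolynomial q) = 1 - X + graphPolynomial (derivative q) := by
  simp only [graphPolynomial, derivative_add, derivative_X, derivative_C_mul, derivative_map]
  ring

theorem eval_ofReal_derivative_graphPolynomial_ne_zero (q : ℝ[X]) (t : ℝ) :
    (derivative (graphPolynomial q)).eval (t : ℂ) ≠ 0 := fun h => by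
  simpa [derivative_graphPolynomial, eval_ofReal_graphPolynomial] using congrArg Complex.re h

theorem pow_dvd_graphPolynomial_sub_X {q : ℝ[X]} {a : ℝ} {n : ℕ} (h : (X - C a) ^ n ∣ q) :
    (X - C (a : ℂ)) ^ n ∣ graphPolynomial q - X := by
  rw [graphPolynomial, add_sub_cancel_left]
  simpa using (Polynomial.map_dvd Complex.ofRealHom h).mul_left (C Complex.I)

theorem exists_eval_graphPolynomial_ne_zero {W : ℂ[X]} (hW : W ≠ 0) (q : ℝ[X]) :
    ∃ μ : ℝ, ∀ t : ℝ, q.eval t ≠ 0 → W.eval ((graphPolynomial (C μ * q)).eval (t : ℂ)) ≠ 0 := by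
  -- A root `ζ` of `W` lies on the graph of `μ q` only if `μ = im ζ / q(re ζ)`.
  obtain ⟨μ, hμ⟩ := Finset.exists_notMem (W.roots.toFinset.image fun ζ => ζ.im / q.eval ζ.re)
  refine ⟨μ, fun t ht hroot => hμ ?_⟩
  refine Finset.mem_image.2 ⟨_, Multiset.mem_toFinset.2 ((mem_roots hW).2 hroot), ?_⟩
  rw [eval_ofReal_graphPolynomial, eval_mul, eval_C, mul_div_cancel_right₀ _ ht]

theorem wronskian_comp {R : Type*} [CommRing R] (A B Q : R[X]) :
    (A.comp Q).wronskian (B.comp Q) = derivative Q * (A.wronskian B).comp Q := by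
  simp only [wronskian, derivative_comp, sub_comp, mul_comp]
  ring

/-- The pair `(v, v')` for the polynomial curve `v = (P, Q)` in the plane. -/
noncomputable def polynomialState {K : Type*} [CommRing K] (P Q : K[X]) (z : K) :
    (K × K) × (K × K) :=
  ((P.eval z, Q.eval z), (derivative P).eval z, (derivative Q).eval z)

theorem wedge_polynomialState {K : Type*} [CommRing K] (P Q : K[X]) (z : K) :
    wedge (polynomialState P Q z).1 (polynomialState P Q z).2 = (P.wronskian Q).eval z := by
  simp only [wedge, polynomialState, wronskian, eval_sub, eval_mul]
  ring

theorem polynomialState_eq_and_eq_of_jet_eq {K : Type*} [Field K] {P Q : K[X]} {z : K}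
    {x : (K × K) × (K × K)} {y : K × K} (hP : jet P z = (x.1.1, x.2.1, y.1))
    (hQ : jet Q z = (x.1.2, x.2.2, y.2)) :
    polynomialState P Q z = x ∧ (polynomialState (derivative P) (derivative Q) z).2 = y := by
  simp only [jet, Prod.mk.injEq] at hP hQ
  simp only [polynomialState, hP, hQ, Prod.mk.eta, true_and]

theorem exists_polynomialState_eq {a b : ℝ} (hab : a < b) {xa xb : (ℂ × ℂ) × (ℂ × ℂ)}
    (ha : wedge xa.1 xa.2 ≠ 0) (hb : wedge xb.1 xb.2 ≠ 0) (ya yb : ℂ × ℂ) :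
    ∃ P Q : ℂ[X],
      (polynomialState P Q a = xa ∧ (polynomialState (derivative P) (derivative Q) a).2 = ya) ∧
      (polynomialState P Q b = xb ∧ (polynomialState (derivative P) (derivative Q) b).2 = yb) ∧
      ∀ t ∈ Icc a b, wedge (polynomialState P Q t).1 (polynomialState P Q t).2 ≠ 0 := by
  have hab' := Complex.ofReal_injective.ne hab.ne
  obtain ⟨A, hAa, hAb⟩ :=
    exists_jet_eq_and_jet_eq hab' (xa.1.1, xa.2.1, ya.1) (xb.1.1, xb.2.1, yb.1)
  obtain ⟨B, hBa, hBb⟩ :=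
    exists_jet_eq_and_jet_eq hab' (xa.1.2, xa.2.2, ya.2) (xb.1.2, xb.2.2, yb.2)
  have hW : A.wronskian B ≠ 0 := fun h => ha (by
    rw [← (polynomialState_eq_and_eq_of_jet_eq hAa hBa).1, wedge_polynomialState, h, eval_zero])
  -- Bending the segment into the complex plane avoids the zeros of the Wronskian of `A` and `B`.
  let q : ℝ[X] := (X - C a) ^ 3 * (X - C b) ^ 3
  obtain ⟨μ, hμ⟩ := exists_eval_graphPolynomial_ne_zero hW q
  set Γ := graphPolynomial (C μ * q)
  have hjet_a (P : ℂ[X]) : jet (P.comp Γ) a = jet P a :=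
    jet_comp_of_dvd_sub P (pow_dvd_graphPolynomial_sub_X ((dvd_mul_right _ _).mul_left _))
  have hjet_b (P : ℂ[X]) : jet (P.comp Γ) b = jet P b :=
    jet_comp_of_dvd_sub P (pow_dvd_graphPolynomial_sub_X ((dvd_mul_left _ _).mul_left _))
  have hstate_a := polynomialState_eq_and_eq_of_jet_eq ((hjet_a A).trans hAa) ((hjet_a B).trans hBa)
  have hstate_b := polynomialState_eq_and_eq_of_jet_eq ((hjet_b A).trans hAb) ((hjet_b B).trans hBb)
  refine ⟨A.comp Γ, B.comp Γ, hstate_a, hstate_b, fun t _ => ?_⟩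
  rcases eq_or_ne t a with rfl | hta
  · rwa [hstate_a.1]
  rcases eq_or_ne t b with rfl | htb
  · rwa [hstate_b.1]
  rw [wedge_polynomialState, wronskian_comp, eval_mul, eval_comp]
  refine mul_ne_zero (eval_ofReal_derivative_graphPolynomial_ne_zero _ t) (hμ t ?_)
  simp [q, sub_ne_zero, hta, htb]

theorem hasDerivAt_polynomialState {𝕜 : Type*} [NontriviallyNormedField 𝕜] (P Q : 𝕜[X]) (z : 𝕜) :
    HasDerivAt (polynomialState P Q) (polynomialState (derivative P) (derivative Q) z) z :=
  ((P.hasDerivAt z).prodMk (Q.hasDerivAt z)).prodMk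
    (((derivative P).hasDerivAt z).prodMk ((derivative Q).hasDerivAt z))

end GraphPolynomial

theorem continuousAt_cramerCoeff {X 𝕜 : Type*} [TopologicalSpace X] [NontriviallyNormedField 𝕜]
    {u : X → (𝕜 × 𝕜) × (𝕜 × 𝕜)} {a : X → 𝕜 × 𝕜} {t : X} (hu : ContinuousAt u t)
    (ha : ContinuousAt a t) (hw : wedge (u t).1 (u t).2 ≠ 0) :
    ContinuousAt (fun t => cramerCoeff (u t) (a t)) t := by
  have hwedge {v w : X → 𝕜 × 𝕜} (hv : ContinuousAt v t) (hw : ContinuousAt w t) :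
      ContinuousAt (fun t => wedge (v t) (w t)) t :=
    continuous_wedge.continuousAt.comp (hv.prodMk hw)
  exact ((hwedge hu.fst ha).div (hwedge hu.fst hu.snd) hw).prodMk
    ((hwedge ha hu.snd).div (hwedge hu.fst hu.snd) hw)

theorem exists_connecting_coefficient {a b : ℝ} (hab : a < b) {xa xb : (ℂ × ℂ) × (ℂ × ℂ)}
    (ha : wedge xa.1 xa.2 ≠ 0) (hb : wedge xb.1 xb.2 ≠ 0) (ca cb : ℂ × ℂ) :
    ∃ (c : ℝ → ℂ × ℂ) (u : ℝ → (ℂ × ℂ) × (ℂ × ℂ)), ContinuousOn c (Icc a b) ∧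
      (c a = ca ∧ c b = cb) ∧ (u a = xa ∧ u b = xb) ∧
      ∀ t ∈ Icc a b, HasDerivAt u (companion (ℂ × ℂ) (c t) (u t)) t := by
  obtain ⟨P, Q, ⟨hxa, hya⟩, ⟨hxb, hyb⟩, hw⟩ := exists_polynomialState_eq hab ha hb
    (companion (ℂ × ℂ) ca xa).2 (companion (ℂ × ℂ) cb xb).2
  set u := polynomialState P Q
  set u' := polynomialState P.derivative Q.derivative
  have hu (z : ℂ) : HasDerivAt u (u' z) z := hasDerivAt_polynomialState P Q z
  have hu' (z : ℂ) : ContinuousAt u' z := (hasDerivAt_polynomialState _ _ z).continuousAt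
  refine ⟨fun t => cramerCoeff (u t) (u' t).2, fun t => u t, fun t ht => ?_, ⟨?_, ?_⟩, ⟨hxa, hxb⟩,
    fun t ht => ?_⟩
  · exact ((continuousAt_cramerCoeff (hu t).continuousAt (hu' t).snd (hw t ht)).comp
      (f := Complex.ofReal) Complex.continuous_ofReal.continuousAt).continuousWithinAt
  · simp only [hxa, hya, cramerCoeff_companion ha]
  · simp only [hxb, hyb, cramerCoeff_companion hb]
  · rw [companion_cramerCoeff (hw t ht)]
    exact ((hu t).scomp t Complex.ofRealCLM.hasDerivAt).congr_deriv (one_smul ℂ _)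

/-! ### Fusion of two equations -/

theorem exists_continuous_glue {E : Type*} [AddCommGroup E] [TopologicalSpace E]
    [IsTopologicalAddGroup E] {a b : ℝ} (hab : a ≤ b) {f g h : ℝ → E} (hf : Continuous f)
    (hg : ContinuousOn g (Icc a b)) (hh : Continuous h) (ha : g a = f a) (hb : g b = h b) :
    ∃ F : ℝ → E, Continuous F ∧ (∀ t ≤ a, F t = f t) ∧ (∀ t ∈ Icc a b, F t = g t) ∧
      ∀ t ≥ b, F t = h t := by
  refine ⟨fun t => f (min t a) - f a + IccExtend hab (fun t => g t) t + h (max t b) - h b,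
    ?_, fun t ht => ?_, fun t ht => ?_, fun t ht => ?_⟩
  · have := (continuousOn_iff_continuous_domRestrict.1 hg).Icc_extend' (h := hab)
    fun_prop
  · simp only [min_eq_left ht, IccExtend_of_le_left _ _ ht, ha, max_eq_right (ht.trans hab)]
    abel
  · simp only [min_eq_right ht.1, IccExtend_of_mem _ _ ht, max_eq_right ht.2]
    abel
  · simp only [min_eq_right (hab.trans ht), IccExtend_of_right_le _ _ ht, hb, max_eq_left ht]
    abel

section EntireApproximation

variable {E : Type*} [NormedAddCommGroup E] [NormedSpace ℂ E]

theorem exists_hasCompactSupport_eq_add_smul_add {R m : ℝ} (hR : 0 < R) (hm : 8 * R ≤ m)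
    {c c₁ c₂ : ℝ → E} (hc : Continuous c) (hc₁ : Continuous c₁) (hc₂ : Continuous c₂)
    (hcc₁ : ∀ t ≤ 4 * R, c t = c₁ t) (hcc₂ : ∀ t ≥ m - 4 * R, c t = c₂ t) :
    ∃ (η : ℝ → ℂ) (ρ : ℝ → E), (Continuous η ∧ HasCompactSupport η) ∧
      (Continuous ρ ∧ HasCompactSupport ρ) ∧
      (∀ t ≤ 4 * R, η t = 0 ∧ ρ t = 0) ∧ (∀ t ∈ closedBall m (3 * R), η t = 1 ∧ ρ t = 0) ∧
      ∀ t ≤ m, c₁ t + η t • (c₂ t - c₁ t) + ρ t = c t := by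
  let bump : ContDiffBump m := ⟨3 * R, 4 * R, by linarith, by linarith⟩
  let η (t : ℝ) : ℂ := bump t
  let ρ (t : ℝ) : E := c t - c₁ t - η (min t m) • (c₂ t - c₁ t)
  have hη : Continuous η := Complex.continuous_ofReal.comp bump.continuous
  have hη_zero {t : ℝ} (ht : t ≤ m - 4 * R) : η t = 0 := by
    simp only [η, bump.zero_of_le_dist (x := t) (by
      rw [dist_comm]; exact (le_sub_comm.1 ht).trans (le_abs_self _)), Complex.ofReal_zero]
  have hη_one {t : ℝ} (ht : t ∈ closedBall m (3 * R)) : η t = 1 := by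
    simp only [η, bump.one_of_mem_closedBall ht, Complex.ofReal_one]
  have hρ_left {t : ℝ} (ht : t ≤ 4 * R) : ρ t = 0 := by
    simp only [ρ, hcc₁ t ht, hη_zero ((min_le_left t m).trans (by linarith)), sub_self, zero_smul]
  have hρ_right {t : ℝ} (ht : m - 3 * R ≤ t) : ρ t = 0 := by
    have hmin : min t m ∈ closedBall m (3 * R) := by
      rw [Real.closedBall_eq_Icc]
      exact ⟨le_min ht (by linarith), (min_le_right t m).trans (by linarith)⟩
    simp only [ρ, hcc₂ t (by linarith), hη_one hmin, one_smul, sub_self]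
  refine ⟨η, ρ, ⟨hη, bump.hasCompactSupport.comp_left Complex.ofReal_zero⟩,
    ⟨by fun_prop, .intro (isCompact_Icc (a := 4 * R) (b := m - 3 * R)) fun t ht => ?_⟩,
    fun t ht => ⟨hη_zero (by linarith), hρ_left ht⟩, fun t ht => ⟨hη_one ht, hρ_right ?_⟩,
    fun t ht => ?_⟩
  · rcases not_and_or.1 ht with h | h
    exacts [hρ_left (le_of_not_ge h), hρ_right (le_of_not_ge h)]
  · rw [Real.closedBall_eq_Icc] at ht
    exact ht.1
  · simp only [ρ, min_eq_left ht]
    abel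

variable [CompleteSpace E]

theorem tendstoUniformlyOn_add_gaussConv_smul_add {η : ℝ → ℂ} {ρ : ℝ → E} {f g : ℂ → E}
    {K : Set ℂ} (hη : Continuous η) (hηc : HasCompactSupport η) (hρ : Continuous ρ)
    (hρc : HasCompactSupport ρ) (hg : Continuous g) (hK : IsCompact K)
    (hKη : K ⊆ gaussDomain η) (hKρ : K ⊆ gaussDomain ρ) :
    TendstoUniformlyOn (fun b z => f z + gaussConv η b z • g z + gaussConv ρ b z)
      (fun z => f z + η z.re • g z + ρ z.re) atTop K := by
  have hconst (h : ℂ → E) : TendstoUniformlyOn (fun (_ : ℝ) => h) h atTop K := fun _ hu =>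
    .of_forall fun _ _ _ => refl_mem_uniformity hu
  have hsmul : TendstoUniformlyOn (fun b z => gaussConv η b z • g z)
      (fun z => η z.re • g z) atTop K := by
    rw [← tendstoLocallyUniformlyOn_iff_tendstoUniformlyOn_of_compact hK]
    exact ((tendstoUniformlyOn_gaussConv hη hηc).mono hKη).tendstoLocallyUniformlyOn.fun_smul₀
      (hconst g).tendstoLocallyUniformlyOn (by fun_prop) (by fun_prop)
  exact ((hconst f).add hsmul).add ((tendstoUniformlyOn_gaussConv hρ hρc).mono hKρ)

theorem exists_entire_tendstoUniformlyOn {c₁ c₂ : ℂ → E} (hc₁ : Differentiable ℂ c₁)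
    (hc₂ : Differentiable ℂ c₂) {R m : ℝ} (hR : 0 < R) (hm : 8 * R ≤ m) {c : ℝ → E}
    (hc : Continuous c) (hcc₁ : ∀ t ≤ 4 * R, c t = c₁ t) (hcc₂ : ∀ t ≥ m - 4 * R, c t = c₂ t) :
    ∃ d : ℝ → ℂ → E, (∀ b, Differentiable ℂ (d b)) ∧
      TendstoUniformlyOn d c₁ atTop (closedBall 0 R) ∧
      TendstoUniformlyOn d c₂ atTop (closedBall (m : ℂ) R) ∧
      TendstoUniformlyOn (fun b (t : ℝ) => d b t) c atTop (Icc 0 m) := by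
  have hofReal := Complex.continuous_ofReal
  obtain ⟨η, ρ, ⟨hη, hηc⟩, ⟨hρ, hρc⟩, hleft, hright, heq⟩ :=
    exists_hasCompactSupport_eq_add_smul_add hR hm hc (hc₁.continuous.comp hofReal)
      (hc₂.continuous.comp hofReal) hcc₁ hcc₂
  have hlim {K : Set ℂ} := tendstoUniformlyOn_add_gaussConv_smul_add (K := K) (f := c₁) hη hηc hρ
    hρc (hc₂.sub hc₁).continuous
  have hleft' (t : ℝ) (ht : t ∈ closedBall 0 (3 * R)) : η t = 0 ∧ ρ t = 0 := by
    rw [Real.closedBall_eq_Icc] at ht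
    exact hleft t (by linarith [ht.2])
  refine ⟨fun b z => c₁ z + gaussConv η b z • (c₂ - c₁) z + gaussConv ρ b z, fun b => ?_, ?_, ?_,
    ?_⟩
  · exact (hc₁.add ((differentiable_gaussConv hη hηc b).smul (hc₂.sub hc₁))).add
      (differentiable_gaussConv hρ hρc b)
  · rw [← Complex.ofReal_zero]
    have hKη := closedBall_subset_gaussDomain fun t ht => (hleft' t ht).1
    have hKρ := closedBall_subset_gaussDomain fun t ht => (hleft' t ht).2
    refine (hlim (isCompact_closedBall _ R) (fun z hz => (hKη hz).1)
      fun z hz => (hKρ hz).1).congr_right fun z hz => ?_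
    simp only [(hKη hz).2.out, (hKρ hz).2.out, zero_smul, add_zero]
  · have hKη := closedBall_subset_gaussDomain fun t ht => (hright t ht).1
    have hKρ := closedBall_subset_gaussDomain fun t ht => (hright t ht).2
    refine (hlim (isCompact_closedBall _ R) (fun z hz => (hKη hz).1)
      fun z hz => (hKρ hz).1).congr_right fun z hz => ?_
    simp only [(hKη hz).2.out, (hKρ hz).2.out, one_smul, add_zero, Pi.sub_apply,
      add_sub_cancel]
  · have hsegment := hlim (K := Complex.ofReal '' Icc 0 m)
      (isCompact_Icc.image hofReal)
      (image_subset_iff.2 fun t _ => ofReal_mem_gaussDomain η t)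
      (image_subset_iff.2 fun t _ => ofReal_mem_gaussDomain ρ t)
    exact ((hsegment.comp _).mono (subset_preimage_image _ _)).congr_right fun t ht => heq t ht.2

end EntireApproximation

theorem IsSolution.hasDerivAt_ofReal {E : Type*} [NormedAddCommGroup E] [NormedSpace ℂ E]
    {c : ℂ → ℂ × ℂ} {u : ℂ → E × E} (hu : IsSolution c u) (t : ℝ) :
    HasDerivAt (fun t : ℝ => u t) (companion E (c t) (u t)) t :=
  ((hu t).scomp t Complex.ofRealCLM.hasDerivAt).congr_deriv (one_smul ℂ _)

theorem tendsto_of_isSolution_of_tendstoUniformlyOn_Icc {ι E : Type*} [NormedAddCommGroup E]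
    [NormedSpace ℂ E] {l : Filter ι} {a b : ℝ} (hab : a ≤ b) {c : ℝ → ℂ × ℂ} {u : ℝ → E × E}
    (hc : ContinuousOn c (Icc a b))
    (hu : ∀ t ∈ Icc a b, HasDerivAt u (companion E (c t) (u t)) t) {d : ι → ℂ → ℂ × ℂ}
    {x : ι → ℂ → E × E} (hx : ∀ i, IsSolution (d i) (x i))
    (hlim : TendstoUniformlyOn (fun i (t : ℝ) => d i t) c l (Icc a b))
    (hinit : Tendsto (fun i => x i a) l (𝓝 (u a))) : Tendsto (fun i => x i b) l (𝓝 (u b)) :=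
  (tendstoUniformlyOn_Icc_of_hasDerivAt
    (uniformContinuous_companion.continuous.comp_continuousOn hc) hu
    (fun i t _ => (hx i).hasDerivAt_ofReal t)
    (uniformContinuous_companion.comp_tendstoUniformlyOn hlim) hinit).tendsto_at
    (right_mem_Icc.2 hab)

theorem exists_fusion {c₁ c₂ : ℂ → ℂ × ℂ} {u₁ u₂ : ℂ → (ℂ × ℂ) × (ℂ × ℂ)}
    (hc₁ : Differentiable ℂ c₁) (hu₁ : IsSolution c₁ u₁)
    (hw₁ : ∀ z, wedge (u₁ z).1 (u₁ z).2 ≠ 0) (hc₂ : Differentiable ℂ c₂)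
    (hu₂ : IsSolution c₂ u₂) (hw₂ : ∀ z, wedge (u₂ z).1 (u₂ z).2 ≠ 0) {R m ε : ℝ} (hR : 0 < R)
    (hm : 8 * R < m) (hε : 0 < ε) :
    ∃ d u, Differentiable ℂ d ∧ IsSolution d u ∧ u 0 = u₁ 0 ∧
      (∀ z ∈ closedBall 0 R, dist (d z) (c₁ z) < ε) ∧
      ∀ z ∈ closedBall (m : ℂ) R, dist (u z) (u₂ z) < ε := by
  have hofReal := Complex.continuous_ofReal
  obtain ⟨c₀, u₀, hc₀, ⟨hc₀a, hc₀b⟩, ⟨hu₀a, hu₀b⟩, hu₀⟩ :=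
    exists_connecting_coefficient (a := 4 * R) (b := m - 4 * R) (by linarith) (hw₁ (4 * R : ℝ))
      (hw₂ (m - 4 * R : ℝ)) (c₁ (4 * R : ℝ)) (c₂ (m - 4 * R : ℝ))
  obtain ⟨c, hc, hcc₁, hcc₀, hcc₂⟩ := exists_continuous_glue (by linarith)
    (hc₁.continuous.comp hofReal) hc₀ (hc₂.continuous.comp hofReal) hc₀a hc₀b
  obtain ⟨d, hd, hd₁, hd₂, hdc⟩ := exists_entire_tendstoUniformlyOn hc₁ hc₂ hR hm.le hc hcc₁ hcc₂
  choose u hu hu_zero using fun b => exists_isSolution (hd b) 0 (u₁ 0)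
  have hlim_left : Tendsto (fun b => u b (4 * R : ℝ)) atTop (𝓝 (u₁ (4 * R : ℝ))) :=
    tendsto_of_isSolution_of_tendstoUniformlyOn_Icc (a := 0) (by linarith)
      (hc₁.continuous.comp hofReal).continuousOn (fun t _ => hu₁.hasDerivAt_ofReal t) hu
      ((hdc.mono (Icc_subset_Icc_right (by linarith))).congr_right fun t ht => hcc₁ t ht.2)
      (by simp [hu_zero])
  have hlim_middle : Tendsto (fun b => u b (m - 4 * R : ℝ)) atTop (𝓝 (u₂ (m - 4 * R : ℝ))) := by
    rw [← hu₀b]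
    exact tendsto_of_isSolution_of_tendstoUniformlyOn_Icc (by linarith) hc₀ hu₀ hu
      ((hdc.mono (Icc_subset_Icc (by linarith) (by linarith))).congr_right hcc₀)
      (by rwa [hu₀a])
  have hlim_right : Tendsto (fun b => u b m) atTop (𝓝 (u₂ m)) :=
    tendsto_of_isSolution_of_tendstoUniformlyOn_Icc (by linarith)
      (hc₂.continuous.comp hofReal).continuousOn (fun t _ => hu₂.hasDerivAt_ofReal t) hu
      ((hdc.mono (Icc_subset_Icc_left (by linarith))).congr_right fun t ht => hcc₂ t ht.1)
      hlim_middle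
  have hlim : TendstoUniformlyOn u u₂ atTop (closedBall m R) :=
    tendstoUniformlyOn_closedBall_of_hasDerivAt
      (uniformContinuous_companion.continuous.comp hc₂.continuous).continuousOn
      (fun z _ => hu₂ z) (fun b z _ => hu b z)
      (uniformContinuous_companion.comp_tendstoUniformlyOn hd₂) hlim_right
  obtain ⟨b, hdb, hub⟩ := ((Metric.tendstoUniformlyOn_iff.1 hd₁ ε hε).and
    (Metric.tendstoUniformlyOn_iff.1 hlim ε hε)).exists
  exact ⟨d b, u b, hd b, hu b, hu_zero b, fun z hz => by rw [dist_comm]; exact hdb z hz,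
    fun z hz => by rw [dist_comm]; exact hub z hz⟩

/-! ### A universal equation -/

theorem exists_forall_mem_closure_range {ι X Y : Type*} [TopologicalSpace X] [BaireSpace X]
    [Nonempty X] [TopologicalSpace Y] [SecondCountableTopology Y] {T : ι → X → Y}
    (hT : ∀ i, Continuous (T i)) {S : Set Y}
    (hS : ∀ y ∈ S, ∀ V ∈ 𝓝 y, Dense {x | ∃ i, T i x ∈ V}) :
    ∃ x, ∀ y ∈ S, y ∈ closure (range (T · x)) := by
  let B : Set (Set Y) := {V ∈ countableBasis Y | (V ∩ S).Nonempty}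
  have hdense : Dense (⋂ V ∈ B, {x | ∃ i, T i x ∈ V}) := by
    refine dense_biInter_of_isOpen (fun V hV => ?_)
      ((countable_countableBasis Y).mono (sep_subset _ _)) fun V hV => ?_
    · rw [ofPred_exists]
      exact isOpen_iUnion fun i => (isOpen_of_mem_countableBasis hV.1).preimage (hT i)
    · obtain ⟨y, hyV, hyS⟩ := hV.2
      exact hS y hyS V ((isOpen_of_mem_countableBasis hV.1).mem_nhds hyV)
  obtain ⟨x, hx⟩ := hdense.nonempty
  refine ⟨x, fun y hy => ((isBasis_countableBasis Y).mem_closure_iff).2 fun V hV hyV => ?_⟩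
  obtain ⟨i, hi⟩ := mem_iInter₂.1 hx V ⟨hV, y, hyV, hy⟩
  exact ⟨T i x, hi, i, rfl⟩

theorem exists_closedBall_subset_of_mem_nhds {X Y : Type*} [PseudoMetricSpace X]
    [PseudoMetricSpace Y] (x₀ : X) {f : C(X, Y)} {s : Set C(X, Y)} (hs : s ∈ 𝓝 f) :
    ∃ r, ∃ ε > 0, {g : C(X, Y) | ∀ x ∈ closedBall x₀ r, dist (g x) (f x) < ε} ⊆ s := by
  obtain ⟨W, hW, hWs⟩ := UniformSpace.mem_nhds_iff_symm.1 hs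
  obtain ⟨K, V, hK, hV, hKV⟩ := (ContinuousMap.mem_compactConvergence_entourage_iff W).1 hW
  obtain ⟨r, hr⟩ := hK.isBounded.subset_closedBall x₀
  obtain ⟨ε, hε, hεV⟩ := mem_uniformity_dist.1 hV
  exact ⟨r, ε, hε, fun g hg => hWs.2 <| hKV fun x hx => hεV (by
    rw [dist_comm]; exact hg x (hr hx))⟩

/-- The entire functions with values in `E`, with the topology of locally uniform convergence. -/
abbrev EntireFunction (E : Type*) [NormedAddCommGroup E] [NormedSpace ℂ E] : Type _ :=
  {c : C(ℂ, E) // Differentiable ℂ c}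

theorem IsSolution.continuous {E : Type*} [NormedAddCommGroup E] [NormedSpace ℂ E]
    {c : ℂ → ℂ × ℂ} {u : ℂ → E × E} (hu : IsSolution c u) : Continuous u :=
  continuous_iff_continuousAt.2 fun z => (hu z).continuousAt

namespace EntireFunction

theorem isClosed_setOf_differentiable (E : Type*) [NormedAddCommGroup E] [NormedSpace ℂ E]
    [CompleteSpace E] : IsClosed {c : C(ℂ, E) | Differentiable ℂ c} := by
  refine isClosed_of_closure_subset fun c hc => ?_
  obtain ⟨u, hu, hlim⟩ := mem_closure_iff_seq_limit.1 hc
  exact differentiableOn_univ.1 <| (tendstoLocallyUniformlyOn_univ.2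
    (ContinuousMap.tendsto_iff_tendstoLocallyUniformly.1 hlim)).differentiableOn
    (.of_forall fun n => (hu n).differentiableOn) isOpen_univ

instance {E : Type*} [NormedAddCommGroup E] [NormedSpace ℂ E] [CompleteSpace E] :
    BaireSpace (EntireFunction E) :=
  have := (isClosed_setOf_differentiable E).isCompletelyPseudoMetrizableSpace
  inferInstanceAs (BaireSpace {c : C(ℂ, E) | Differentiable ℂ c})

instance {E : Type*} [NormedAddCommGroup E] [NormedSpace ℂ E] : Nonempty (EntireFunction E) :=
  ⟨⟨0, differentiable_const 0⟩⟩

variable {E : Type*} [NormedAddCommGroup E] [NormedSpace ℂ E]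

theorem tendsto_of_isSolution {ι : Type*} {l : Filter ι} {c : ι → EntireFunction (ℂ × ℂ)}
    {c₀ : EntireFunction (ℂ × ℂ)} {u : ι → C(ℂ, E × E)} {u₀ : C(ℂ, E × E)}
    (hc : Tendsto c l (𝓝 c₀)) (hu : ∀ i, IsSolution (c i).1 (u i)) (hu₀ : IsSolution c₀.1 u₀)
    (hinit : Tendsto (u · 0) l (𝓝 (u₀ 0))) : Tendsto u l (𝓝 u₀) := by
  rw [tendsto_subtype_rng, ContinuousMap.tendsto_iff_tendstoLocallyUniformly] at hc
  rw [ContinuousMap.tendsto_iff_tendstoLocallyUniformly, ← tendstoLocallyUniformlyOn_univ]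
  exact tendstoLocallyUniformlyOn_of_hasDerivAt isOpen_univ isPreconnected_univ
    (uniformContinuous_companion.continuous.comp c₀.1.continuous).continuousOn
    (fun z _ => hu₀ z) (fun i z _ => hu i z)
    (tendstoLocallyUniformlyOn_univ.2
      (uniformContinuous_companion.comp_tendstoLocallyUniformly hc)) (mem_univ 0) hinit

theorem exists_isSolution_apply_zero_eq [CompleteSpace E] (c : EntireFunction (ℂ × ℂ))
    (x : E × E) : ∃ u : C(ℂ, E × E), IsSolution c.1 u ∧ u 0 = x := by
  obtain ⟨u, hu, hu_zero⟩ := exists_isSolution c.2 0 x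
  exact ⟨⟨u, hu.continuous⟩, hu, hu_zero⟩

end EntireFunction

theorem IsSolution.eq_of_apply_zero_eq {E : Type*} [NormedAddCommGroup E] [NormedSpace ℂ E]
    {c : EntireFunction (ℂ × ℂ)} {u v : C(ℂ, E × E)} (hu : IsSolution c.1 u)
    (hv : IsSolution c.1 v) (h : u 0 = v 0) : u = v := by
  refine tendsto_nhds_unique (f := fun _ : Unit => u) (l := ⊤) tendsto_const_nhds ?_
  exact EntireFunction.tendsto_of_isSolution tendsto_const_nhds (fun _ => hu) hv
    (h ▸ tendsto_const_nhds)

/-- The solution `(v, v')` of `v'' = p v' + q v`, where `c = (p, q)`, for the curve `v` in `ℂ × ℂ`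
with `v 0 = (1, 0)` and `v' 0 = (0, 1)`. -/
noncomputable def standardSolution (c : EntireFunction (ℂ × ℂ)) : C(ℂ, (ℂ × ℂ) × (ℂ × ℂ)) :=
  (c.exists_isSolution_apply_zero_eq ((1, 0), (0, 1))).choose

theorem isSolution_standardSolution (c : EntireFunction (ℂ × ℂ)) :
    IsSolution c.1 (standardSolution c) :=
  (c.exists_isSolution_apply_zero_eq ((1, 0), (0, 1))).choose_spec.1

theorem standardSolution_zero (c : EntireFunction (ℂ × ℂ)) :
    standardSolution c 0 = ((1, 0), (0, 1)) :=
  (c.exists_isSolution_apply_zero_eq ((1, 0), (0, 1))).choose_spec.2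

theorem wedge_standardSolution_ne_zero (c : EntireFunction (ℂ × ℂ)) (z : ℂ) :
    wedge (standardSolution c z).1 (standardSolution c z).2 ≠ 0 :=
  (isSolution_standardSolution c).wedge_ne_zero c.2 (z₀ := 0)
    (by simp [standardSolution_zero, wedge]) z

theorem continuous_standardSolution : Continuous standardSolution :=
  continuous_iff_continuousAt.2 fun c => EntireFunction.tendsto_of_isSolution tendsto_id
    isSolution_standardSolution (isSolution_standardSolution c)
    (by simp only [standardSolution_zero, tendsto_const_nhds])

theorem IsSolution.comp_sub_const {E : Type*} [NormedAddCommGroup E] [NormedSpace ℂ E]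
    {c : ℂ → ℂ × ℂ} {u : ℂ → E × E} (hu : IsSolution c u) (a : ℂ) :
    IsSolution (fun z => c (z - a)) (fun z => u (z - a)) :=
  fun z => (hu (z - a)).comp_sub_const z a

theorem exists_standardSolution_translate_near (c : EntireFunction (ℂ × ℂ)) {c' : ℂ → ℂ × ℂ}
    {u : ℂ → (ℂ × ℂ) × (ℂ × ℂ)} (hc' : Differentiable ℂ c') (hu : IsSolution c' u)
    (hw : ∀ z, wedge (u z).1 (u z).2 ≠ 0) (r : ℝ) {ε : ℝ} (hε : 0 < ε) :
    ∃ d : EntireFunction (ℂ × ℂ), (∀ z ∈ closedBall 0 r, dist (d.1 z) (c.1 z) < ε) ∧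
      ∃ n : ℕ+, ∀ z ∈ closedBall 0 r, dist (standardSolution d (z + n)) (u z) < ε := by
  set R := max r 1
  have hR : 0 < R := lt_max_of_lt_right one_pos
  have hrR : closedBall (0 : ℂ) r ⊆ closedBall 0 R := closedBall_subset_closedBall (le_max_left r 1)
  obtain ⟨n, hn⟩ := exists_nat_gt (8 * R)
  have hn_pos : 0 < n := by
    have : (0 : ℝ) < n := by linarith
    exact_mod_cast this
  obtain ⟨d, x, hd, hx, hx_zero, hdc, hxu⟩ := exists_fusion c.2 (isSolution_standardSolution c)
    (wedge_standardSolution_ne_zero c) (hc'.comp (differentiable_id.sub_const (n : ℂ)))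
    (hu.comp_sub_const n) (fun z => hw (z - n)) hR hn hε
  let d' : EntireFunction (ℂ × ℂ) := ⟨⟨d, hd.continuous⟩, hd⟩
  let x' : C(ℂ, (ℂ × ℂ) × (ℂ × ℂ)) := ⟨x, hx.continuous⟩
  have hx' : standardSolution d' = x' := (isSolution_standardSolution d').eq_of_apply_zero_eq hx
    ((standardSolution_zero d').trans ((standardSolution_zero c).symm.trans hx_zero.symm))
  refine ⟨d', fun z hz => hdc z (hrR hz), ⟨n, hn_pos⟩, fun z hz => ?_⟩
  have hz' : z + n ∈ closedBall ((n : ℝ) : ℂ) R := by simpa using hrR hz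
  have hdist := hxu (z + n) hz'
  rw [add_sub_cancel_right] at hdist
  rwa [hx']

theorem dense_setOf_exists_standardSolution_translate_mem {c : ℂ → ℂ × ℂ}
    {u : C(ℂ, (ℂ × ℂ) × (ℂ × ℂ))} (hc : Differentiable ℂ c) (hu : IsSolution c u)
    (hw : ∀ z, wedge (u z).1 (u z).2 ≠ 0) {V : Set C(ℂ, (ℂ × ℂ) × (ℂ × ℂ))} (hV : V ∈ 𝓝 u) :
    Dense {d | ∃ n : ℕ+, (standardSolution d).comp (.addRight (n : ℂ)) ∈ V} := by
  intro c₀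
  refine mem_closure_iff_nhds.2 fun W hW => ?_
  rw [nhds_subtype_eq_comap] at hW
  obtain ⟨W', hW', hWW'⟩ := hW
  obtain ⟨r₁, ε₁, hε₁, hsub₁⟩ := exists_closedBall_subset_of_mem_nhds 0 hW'
  obtain ⟨r₂, ε₂, hε₂, hsub₂⟩ := exists_closedBall_subset_of_mem_nhds 0 hV
  obtain ⟨d, hdc, n, hdu⟩ := exists_standardSolution_translate_near c₀ hc hu hw (max r₁ r₂)
    (lt_min hε₁ hε₂)
  refine ⟨d, hWW' (hsub₁ fun z hz => ?_), n, hsub₂ fun z hz => ?_⟩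
  · exact (hdc z (closedBall_subset_closedBall (le_max_left _ _) hz)).trans_le (min_le_left _ _)
  · exact (hdu z (closedBall_subset_closedBall (le_max_right _ _) hz)).trans_le (min_le_right _ _)

theorem exists_universal_equation : ∃ c : EntireFunction (ℂ × ℂ), ∀ (c' : ℂ → ℂ × ℂ)
    (u : C(ℂ, (ℂ × ℂ) × (ℂ × ℂ))), Differentiable ℂ c' → IsSolution c' u →
      (∀ z, wedge (u z).1 (u z).2 ≠ 0) →
        u ∈ closure (range fun n : ℕ+ => (standardSolution c).comp (.addRight (n : ℂ))) := by
  obtain ⟨c, hc⟩ := exists_forall_mem_closure_range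
    (T := fun (n : ℕ+) c => (standardSolution c).comp (.addRight (n : ℂ)))
    (S := {u | ∃ c', Differentiable ℂ c' ∧ IsSolution c' u ∧ ∀ z, wedge (u z).1 (u z).2 ≠ 0})
    (fun n => (ContinuousMap.continuous_precomp _).comp continuous_standardSolution)
    fun u ⟨_, hc', hu, hw⟩ _ hV =>
      dense_setOf_exists_standardSolution_translate_mem hc' hu hw hV
  exact ⟨c, fun c' u hc' hu hw => hc u ⟨c', hc', hu, hw⟩⟩

theorem IsSolution.exists_locallyUnivalentFunction_eq_proj {c : ℂ → ℂ × ℂ}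
    {u : ℂ → (ℂ × ℂ) × (ℂ × ℂ)} (hu : IsSolution c u)
    (hw : ∀ z, wedge (u z).1 (u z).2 ≠ 0) (Ω : Opens ℂ) :
    ∃ f : LocallyUnivalentFunction Ω, ∀ z : Ω, f.1 z = proj (u z).1 := by
  have hderiv (z : ℂ) : HasDerivAt (fun z => (u z).1) (u z).2 z := by
    simpa only [companion_apply] using hasDerivAt_fst_comp (hu z)
  exact _root_.exists_locallyUnivalentFunction_eq_proj
    (fun z _ => Differentiable.analyticAt (fun z => (hderiv z).differentiableAt) z)
    fun z _ => by rw [(hderiv z).deriv]; exact hw z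

theorem exists_dist_proj_translate_lt {w u : C(ℂ, (ℂ × ℂ) × (ℂ × ℂ))}
    (h : u ∈ closure (range fun n : ℕ+ => w.comp (.addRight (n : ℂ))))
    (hu : ∀ z, (u z).1 ≠ 0) {K : Set ℂ} (hK : IsCompact K) {ε : ℝ} (hε : 0 < ε) :
    ∃ n : ℕ+, ∀ z ∈ K, dist (proj (w (z + n)).1) (proj (u z).1) < ε := by
  obtain ⟨δ, hδ, hproj⟩ := exists_forall_dist_proj_lt hK
    (continuous_fst.comp u.continuous).continuousOn (fun z _ => hu z) hε
  have hnear : ∀ᶠ v : C(ℂ, (ℂ × ℂ) × (ℂ × ℂ)) in 𝓝 u, ∀ z ∈ K, dist (u z) (v z) < δ :=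
    Metric.tendstoUniformlyOn_iff.1
      (ContinuousMap.tendsto_iff_forall_isCompact_tendstoUniformlyOn.1 tendsto_id K hK) δ hδ
  obtain ⟨_, hv, n, rfl⟩ := mem_closure_iff_nhds.1 h _ hnear
  refine ⟨n, fun z hz => hproj z hz _ ((le_max_left _ _).trans_lt (?_ : dist _ (u z) < δ))⟩
  rw [dist_comm]
  exact hv z hz

theorem mainTheorem9 :
    ∃ f : LocallyUnivalentFunction ⊤,
      ∀ Ω : Opens ℂ, IsSimplyConnected (Ω : Set ℂ) →
        Dense {g : LocallyUnivalentFunction Ω |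
          ∃ n : ℕ, 1 ≤ n ∧ g = f.translate (n : ℂ) Ω} := by
  obtain ⟨c, hc⟩ := exists_universal_equation
  obtain ⟨f, hf⟩ := (isSolution_standardSolution c).exists_locallyUnivalentFunction_eq_proj
    (wedge_standardSolution_ne_zero c) ⊤
  refine ⟨f, fun Ω hΩ => dense_of_forall_exists_dist_lt fun g K hK hKΩ ε hε => ?_⟩
  obtain ⟨c', u, hc', hu, hw, hug⟩ := g.exists_entire_approx hΩ hK hKΩ (half_pos hε)
  obtain ⟨n, hn⟩ := exists_dist_proj_translate_lt (hc c' ⟨u, hu.continuous⟩ hc' hu hw)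
    (fun z => ne_zero_of_wedge_ne_zero (hw z)) hK (half_pos hε)
  refine ⟨f.translate n Ω, ⟨n, n.pos, rfl⟩, fun z hz => ?_⟩
  have hfz : (f.translate n Ω).1 z = proj (standardSolution c (z + n)).1 := hf ⟨z + n, trivial⟩
  rw [hfz, ← add_halves ε]
  exact (dist_triangle _ (proj (u z).1) _).trans_lt (add_lt_add (hn z hz) (hug z hz))
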